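/- Let $U$ be a smooth connected complex algebraic curve, $f\in\mathcal O(U)$ a regular function, and $\nabla=d+df$ the connection $v\mapsto dv+v\,df$ on $\mathcal O_U$. Let $X$ be the smooth completion of $U$, $S=X\setminus U$ (a reduced divisor), $P$ the pole divisor of $f$ on $X$, and $P_{\mathrm{red}}$ its support. Let $\nabla:\mathcal O_X(*S)\to\Omega^1_X(*S)$ be the twisted meromorphic de Rham complex $(\Omega_X^\bullet(*S),\nabla)$ and $H^i_{\mathrm{dR}}(U,\nabla)=\mathbb H^i(U,(\Omega_U^\bullet,\nabla))=\mathbb H^i(X,(\Omega_X^\bullet(*S),\nabla))$. Consider two decreasing filtrations of $(\Omega_X^\bullet(*S),\nabla)$ by subcomplexes, indexed by $\lambda\in\mathbb R$: * the irregular Hodge filtration $F^\lambda(\nabla)$, the part of degree $\ge\lceil\lambda\rceil$ of $\mathcal O_X(\lfloor-\lambda P\rfloor)\xrightarrow{\nabla}\Omega^1_X(\log S)(\lfloor(1-\lambda)P\rfloor)$; * Deligne's filtration $\mathfrak F^\lambda=[\mathfrak F^\lambda\mathcal O_X(*S)\xrightarrow{\nabla}\mathfrak F^\lambda\Omega^1_X(*S)]$,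 where $\mathfrak F^\lambda\mathcal O_X(*S)$ is $0$ if $\lambda>0$, is $\mathcal O_X(S-\lceil\lambda P\rceil)$ if $-1<\lambda\le0$, and is $(\mathfrak F^{\lambda+1}\mathcal O_X(*S))(S+P)$ if $\lambda\le-1$, and where $\mathfrak F^\lambda\Omega^1_X(*S)=\Omega^1_X\otimes\mathfrak F^{\lambda-1}\mathcal O_X(*S)$. Let $\Omega_X^\bullet(\log_F\nabla)=F^0(\nabla)\otimes\mathcal O_X(-P_{\mathrm{red}})$, and let $\Omega_X^\bullet(\log_{\mathfrak F}\nabla)$ be the subcomplex $$\ker\bigl(\mathfrak F^0\mathcal O_X(*S)\xrightarrow{\nabla}\mathfrak F^0\Omega^1_X(*S)/\mathfrak F^{0+}\Omega^1_X(*S)\bigr)\xrightarrow{\nabla}\mathfrak F^{0+}\Omega^1_X(*S),\qquad \mathfrak F^{0+}=\bigcup_{\lambda>0}\mathfrak F^\lambda,$$ with the filtrations induced by $F^\bullet(\nabla)$ and $\mathfrak F^\bullet$ respectively. Then: 1. $\Omega_X^\bullet(\log_F\nabla)$ and $\Omega_X^\bullet(\log_{\mathfrak F}\nabla)$ are the same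 filtered subcomplex of $(\Omega_X^\bullet(*S),\nabla)$. 2. The inclusions of $\Omega_X^\bullet(\log_F\nabla)$ in $(\Omega_X^\bullet(*S),F^\bullet(\nabla))$ and of $\Omega_X^\bullet(\log_{\mathfrak F}\nabla)$ in $(\Omega_X^\bullet(*S),\mathfrak F^\bullet)$ are filtered quasi-isomorphisms, that is, quasi-isomorphisms of the whole complexes and of the $\lambda$-th filtration steps for every $\lambda\in\mathbb R$. 3. The two filtrations induce the same filtration on the twisted de Rham cohomology: for every $\lambda\in\mathbb R$ and every $i$, the images of $\mathbb H^i(X,F^\lambda(\nabla))$ and $\mathbb H^i(X,\mathfrak F^\lambda)$ in $H^i_{\mathrm{dR}}(U,\nabla)$ coincide. -/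

import Mathlib

open CategoryTheory AlgebraicGeometry TopologicalSpace Opposite IsLocalRing

namespace IrregularHodge

theorem isPrincipal_maximalIdeal_of_formallySmooth (R : Type) [CommRing R] [IsLocalRing R]
    [Algebra ℂ R] [Algebra.EssFiniteType ℂ R] [Algebra.FormallySmooth ℂ R]
    (w : Ω[R⁄ℂ]) (hw : ∀ z : Ω[R⁄ℂ], ∃ a : R, z = a • w) :
    (maximalIdeal R).IsPrincipal := by
  have : IsNoetherianRing R := Algebra.EssFiniteType.isNoetherianRing ℂ R
  have : Algebra.EssFiniteType R (ResidueField R) := inferInstance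
  have : Algebra.EssFiniteType ℂ (ResidueField R) := Algebra.EssFiniteType.comp ℂ R _
  have : Algebra.FormallySmooth ℂ (ResidueField R) := inferInstance
  have hsurj : Function.Surjective (algebraMap R (ResidueField R)) := residue_surjective
  have hinj := (Algebra.FormallySmooth.kerCotangentToTensor_injective_iff (R := ℂ) hsurj).2
    inferInstance
  have hker : maximalIdeal R = RingHom.ker (algebraMap R (ResidueField R)) := ker_residue.symm
  have e : (maximalIdeal R).Cotangent ≃ₗ[R] (RingHom.ker (algebraMap R (ResidueField R))).Cotangent :=
    by rw [hker]
  let φ : CotangentSpace R →ₗ[ResidueField R] TensorProduct R (ResidueField R) Ω[R⁄ℂ] :=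
    LinearMap.extendScalarsOfSurjective hsurj
      ((KaehlerDifferential.kerCotangentToTensor ℂ R (ResidueField R)) ∘ₗ e.toLinearMap)
  have hφ : Function.Injective φ := hinj.comp e.injective
  have hgen : ∀ z : TensorProduct R (ResidueField R) Ω[R⁄ℂ],
      ∃ c : ResidueField R, c • (TensorProduct.tmul R (1 : ResidueField R) w) = z := by
    intro z
    induction z using TensorProduct.induction_on with
    | zero => exact ⟨0, by simp⟩
    | tmul c z =>
      obtain ⟨a, rfl⟩ := hw z
      refine ⟨a • c, ?_⟩
      rw [TensorProduct.smul_tmul', TensorProduct.tmul_smul, TensorProduct.smul_tmul']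
      simp
    | add x y hx hy =>
      obtain ⟨c, rfl⟩ := hx
      obtain ⟨d, rfl⟩ := hy
      exact ⟨c + d, add_smul _ _ _⟩
  have : Module.Finite (ResidueField R) (TensorProduct R (ResidueField R) Ω[R⁄ℂ]) :=
    ⟨⟨{TensorProduct.tmul R (1 : ResidueField R) w}, by
      rw [eq_top_iff]
      intro z _
      rw [Finset.coe_singleton, Submodule.mem_span_singleton]
      exact hgen z⟩⟩
  rw [← finrank_cotangentSpace_le_one_iff]
  exact (LinearMap.finrank_le_finrank_of_injective hφ).trans (finrank_le_one _ hgen)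

/-- A regular function `f` on a smooth connected complex curve `U`, together with the smooth
completion `X` of `U`. Here `X` is a smooth proper connected curve over `ℂ`, and `U` a nonempty open
subscheme. -/
structure CompletedCurve where
  X : Scheme.{0}
  str : X ⟶ Spec (CommRingCat.of ℂ)
  [integral : IsIntegral X]
  [proper : IsProper str]
  [smooth : SmoothOfRelativeDimension 1 str]
  U : X.Opens
  [nonempty : Nonempty U]
  f : Γ(X, U)

namespace CompletedCurve
attribute [instance] integral proper smooth nonempty
variable (C : CompletedCurve)

noncomputable instance (x : C.X) : Algebra ℂ (C.X.presheaf.stalk x) :=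
  ((C.X.presheaf.germ ⊤ x trivial).hom.comp
    (C.str.appTop.hom.comp (Scheme.ΓSpecIso (CommRingCat.of ℂ)).inv.hom)).toAlgebra

theorem algebraMap_stalk (V : C.X.Opens) (x : C.X) (hx : x ∈ V) (e : V ≤ C.str ⁻¹ᵁ ⊤) :
    (C.X.presheaf.germ V x hx).hom.comp
      ((C.str.appLE ⊤ V e).hom.comp (Scheme.ΓSpecIso (CommRingCat.of ℂ)).inv.hom) =
      algebraMap ℂ (C.X.presheaf.stalk x) := by
  ext c
  exact C.X.presheaf.germ_res_apply (homOfLE (le_top : V ≤ ⊤)) x hx _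

/-- The function field. -/
abbrev K : Type := C.X.functionField

instance (x : C.X) : IsScalarTower ℂ (C.X.presheaf.stalk x) C.K := by
  refine IsScalarTower.of_algebraMap_eq fun c ↦ ?_
  exact (C.X.presheaf.germ_stalkSpecializes_apply (U := ⊤) trivial
    ((genericPoint_spec C.X).specializes trivial) _).symm

theorem isNoetherianRing_and_isPrincipal (x : C.X) :
    IsNoetherianRing (C.X.presheaf.stalk x) ∧
      (maximalIdeal (C.X.presheaf.stalk x)).IsPrincipal := by
  obtain ⟨W, hW, V, hV, hx, e, hs⟩ :=
    SmoothOfRelativeDimension.exists_isStandardSmoothOfRelativeDimension (n := 1) (f := C.str) x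
  have hWtop : W = ⊤ := by
    have hsub : Subsingleton (Spec (CommRingCat.of ℂ)) :=
      inferInstanceAs (Subsingleton (PrimeSpectrum ℂ))
    refine eq_top_iff.2 fun y _ ↦ ?_
    rw [Subsingleton.elim y (C.str x)]
    exact e hx
  subst hWtop
  let _ : Algebra ℂ Γ(C.X, V) :=
    ((C.str.appLE ⊤ V e).hom.comp (Scheme.ΓSpecIso (CommRingCat.of ℂ)).inv.hom).toAlgebra
  have hstd : Algebra.IsStandardSmoothOfRelativeDimension 1 ℂ Γ(C.X, V) :=
    hs.comp (RingHom.IsStandardSmoothOfRelativeDimension.equiv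
      (Scheme.ΓSpecIso (CommRingCat.of ℂ)).commRingCatIsoToRingEquiv.symm)
  let _ : Algebra Γ(C.X, V) (C.X.presheaf.stalk x) := (C.X.presheaf.germ V x hx).hom.toAlgebra
  have : IsScalarTower ℂ Γ(C.X, V) (C.X.presheaf.stalk x) :=
    IsScalarTower.of_algebraMap_eq' (algebraMap_stalk C V x hx e).symm
  have hloc : IsLocalization.AtPrime (C.X.presheaf.stalk x) (hV.primeIdealOf ⟨x, hx⟩).asIdeal :=
    hV.isLocalization_stalk ⟨x, hx⟩
  have : Nontrivial Γ(C.X, V) := (C.X.presheaf.germ V x hx).hom.domain_nontrivial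
  have : Algebra.IsStandardSmooth ℂ Γ(C.X, V) := hstd.isStandardSmooth
  have : Algebra.EssFiniteType Γ(C.X, V) (C.X.presheaf.stalk x) :=
    Algebra.EssFiniteType.of_isLocalization _ (hV.primeIdealOf ⟨x, hx⟩).asIdeal.primeCompl
  have : Algebra.EssFiniteType ℂ (C.X.presheaf.stalk x) := Algebra.EssFiniteType.comp ℂ Γ(C.X, V) _
  have : Algebra.FormallySmooth Γ(C.X, V) (C.X.presheaf.stalk x) :=
    Algebra.FormallySmooth.of_isLocalization (hV.primeIdealOf ⟨x, hx⟩).asIdeal.primeCompl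
  have : Algebra.FormallySmooth ℂ (C.X.presheaf.stalk x) := .comp ℂ Γ(C.X, V) _
  have hrank := Algebra.IsStandardSmoothOfRelativeDimension.rank_kaehlerDifferential
    (R := ℂ) (S := Γ(C.X, V)) 1
  have : Module.Free Γ(C.X, V) Ω[Γ(C.X, V)⁄ℂ] := inferInstance
  obtain ⟨b⟩ : Nonempty (Module.Basis (Fin 1) Γ(C.X, V) Ω[Γ(C.X, V)⁄ℂ]) := by
    have h1 : Module.finrank Γ(C.X, V) Ω[Γ(C.X, V)⁄ℂ] = 1 := by
      simp [Module.finrank, hrank]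
    exact ⟨Module.basisUnique (Fin 1) h1⟩
  have := KaehlerDifferential.isLocalizedModule_map ℂ Γ(C.X, V) (C.X.presheaf.stalk x)
    (hV.primeIdealOf ⟨x, hx⟩).asIdeal.primeCompl
  refine ⟨Algebra.EssFiniteType.isNoetherianRing ℂ _, ?_⟩
  refine isPrincipal_maximalIdeal_of_formallySmooth _
    (KaehlerDifferential.map ℂ ℂ Γ(C.X, V) (C.X.presheaf.stalk x) (b 0)) fun z ↦ ?_
  obtain ⟨⟨y, s⟩, hy⟩ := IsLocalizedModule.surj (hV.primeIdealOf ⟨x, hx⟩).asIdeal.primeCompl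
    (KaehlerDifferential.map ℂ ℂ Γ(C.X, V) (C.X.presheaf.stalk x)) z
  have hu : IsUnit (algebraMap Γ(C.X, V) (C.X.presheaf.stalk x) s) :=
    IsLocalization.map_units _ s
  refine ⟨((hu.unit⁻¹ : (C.X.presheaf.stalk x)ˣ) : C.X.presheaf.stalk x) *
    algebraMap _ _ (b.repr y 0), ?_⟩
  have hy0 : y = b.repr y 0 • b 0 := by
    conv_lhs => rw [← b.sum_repr y]
    simp
  have h3 : algebraMap Γ(C.X, V) (C.X.presheaf.stalk x) s • z =
      algebraMap Γ(C.X, V) (C.X.presheaf.stalk x) (b.repr y 0) •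
        KaehlerDifferential.map ℂ ℂ Γ(C.X, V) (C.X.presheaf.stalk x) (b 0) := by
    rw [algebraMap_smul, algebraMap_smul, ← map_smul, ← hy0, ← hy]
    rfl
  rw [mul_smul, ← h3, smul_smul, IsUnit.val_inv_mul, one_smul]

/-! ### Functions and forms with prescribed poles -/

/-- The stalk `𝒪_{X,x}`, as a subspace of the function field. -/
noncomputable def regularFunctions (x : C.X) : Submodule ℂ C.K :=
  LinearMap.range (IsScalarTower.toAlgHom ℂ (C.X.presheaf.stalk x) C.K).toLinearMap

/-- The stalk `Ω¹_{X,x}`, as a subspace of the rational forms. -/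
noncomputable def regularForms (x : C.X) : Submodule ℂ Ω[C.K⁄ℂ] :=
  LinearMap.range ((KaehlerDifferential.map ℂ ℂ (C.X.presheaf.stalk x) C.K).restrictScalars ℂ)

/-- The stalk at `x` of `𝒪_X(D)`, where `D` has multiplicity `n` at `x`: the rational functions `g`
with `t ^ n * g` regular at `x`, for `t` a generator of the maximal ideal at `x`. (At the generic
point `t = 0`, and only `n = 0` matters.) -/
noncomputable def functionsWithPole (x : C.X) (n : ℤ) : Submodule ℂ C.K where
  carrier := {g | ∀ t : C.X.presheaf.stalk x,
    Ideal.span {t} = maximalIdeal (C.X.presheaf.stalk x) →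
      algebraMap (C.X.presheaf.stalk x) C.K t ^ n * g ∈ C.regularFunctions x}
  add_mem' hg hh t ht := by
    rw [mul_add]
    exact add_mem (hg t ht) (hh t ht)
  zero_mem' t _ := by
    rw [mul_zero]
    exact zero_mem _
  smul_mem' c g hg t ht := by
    rw [mul_smul_comm]
    exact Submodule.smul_mem _ c (hg t ht)

/-- The stalk at `x` of `Ω¹_X(D)`, where `D` has multiplicity `n` at `x`. -/
noncomputable def formsWithPole (x : C.X) (n : ℤ) : Submodule ℂ Ω[C.K⁄ℂ] where
  carrier := {w | ∀ t : C.X.presheaf.stalk x,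
    Ideal.span {t} = maximalIdeal (C.X.presheaf.stalk x) →
      algebraMap (C.X.presheaf.stalk x) C.K t ^ n • w ∈ C.regularForms x}
  add_mem' hg hh t ht := by
    rw [smul_add]
    exact add_mem (hg t ht) (hh t ht)
  zero_mem' t _ := by
    rw [smul_zero]
    exact zero_mem _
  smul_mem' c g hg t ht := by
    rw [smul_comm]
    exact Submodule.smul_mem _ c (hg t ht)

/-- `f` as a rational function on `X`. -/
noncomputable def fK : C.K := C.X.germToFunctionField C.U C.f

open scoped Classical in
/-- The reduced boundary divisor `S = X ∖ U`. -/
noncomputable def S (x : C.X) : ℤ := if x ∈ C.U then 0 else 1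

/-- The multiplicity at `x` of the pole divisor `P` of `f`. -/
noncomputable def P (x : C.X) : ℕ := sInf {n : ℕ | C.fK ∈ C.functionsWithPole x n}

/-- The reduced divisor `P_red`. -/
noncomputable def Pred (x : C.X) : ℤ := if C.P x = 0 then 0 else 1

/-- The connection `∇ g = dg + g df`, on rational functions. -/
noncomputable def nabla : C.K →ₗ[ℂ] Ω[C.K⁄ℂ] :=
  (KaehlerDifferential.D ℂ C.K).toLinearMap +
    (LinearMap.toSpanSingleton C.K Ω[C.K⁄ℂ] (KaehlerDifferential.D ℂ C.K C.fK)).restrictScalars ℂ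

theorem nabla_apply (g : C.K) : C.nabla g =
    KaehlerDifferential.D ℂ C.K g + g • KaehlerDifferential.D ℂ C.K C.fK := rfl

theorem exists_uniformizer (x : C.X) :
    ∃ t : C.X.presheaf.stalk x, Ideal.span {t} = maximalIdeal (C.X.presheaf.stalk x) := by
  obtain ⟨t, ht⟩ := (C.isNoetherianRing_and_isPrincipal x).2
  exact ⟨t, ht.symm⟩

theorem mem_regularFunctions {x : C.X} {g : C.K} :
    g ∈ C.regularFunctions x ↔ ∃ a : C.X.presheaf.stalk x, algebraMap _ C.K a = g := Iff.rfl

theorem mul_mem_regularFunctions {x : C.X} {g h : C.K} (hg : g ∈ C.regularFunctions x)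
    (hh : h ∈ C.regularFunctions x) : g * h ∈ C.regularFunctions x := by
  obtain ⟨a, rfl⟩ := hg
  obtain ⟨b, rfl⟩ := hh
  exact ⟨a * b, map_mul (algebraMap (C.X.presheaf.stalk x) C.K) a b⟩

theorem smul_mem_regularForms {x : C.X} {g : C.K} {w : Ω[C.K⁄ℂ]}
    (hg : g ∈ C.regularFunctions x) (hw : w ∈ C.regularForms x) : g • w ∈ C.regularForms x := by
  obtain ⟨a, rfl⟩ := hg
  obtain ⟨b, rfl⟩ := hw
  refine ⟨a • b, ?_⟩
  simp only [LinearMap.coe_restrictScalars, map_smul]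
  exact (algebraMap_smul C.K a _).symm

theorem D_mem_regularForms {x : C.X} {g : C.K} (hg : g ∈ C.regularFunctions x) :
    KaehlerDifferential.D ℂ C.K g ∈ C.regularForms x := by
  obtain ⟨a, rfl⟩ := hg
  exact ⟨KaehlerDifferential.D ℂ (C.X.presheaf.stalk x) a,
    KaehlerDifferential.map_D ℂ ℂ (C.X.presheaf.stalk x) C.K a⟩

theorem fK_mem_regularFunctions {x : C.X} (hx : x ∈ C.U) : C.fK ∈ C.regularFunctions x :=
  ⟨C.X.presheaf.germ C.U x hx C.f, C.X.presheaf.germ_stalkSpecializes_apply (U := C.U) hx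
    ((genericPoint_spec C.X).specializes trivial) C.f⟩

theorem functionsWithPole_zero (x : C.X) : C.functionsWithPole x 0 = C.regularFunctions x := by
  obtain ⟨t, ht⟩ := C.exists_uniformizer x
  ext g
  refine ⟨fun h ↦ by simpa using h t ht, fun h t _ ↦ by simpa using h⟩

theorem formsWithPole_zero (x : C.X) : C.formsWithPole x 0 = C.regularForms x := by
  obtain ⟨t, ht⟩ := C.exists_uniformizer x
  ext g
  refine ⟨fun h ↦ by simpa using h t ht, fun h t _ ↦ by simpa using h⟩

theorem regularFunctions_eq_top {x : C.X} (h : maximalIdeal (C.X.presheaf.stalk x) = ⊥) :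
    C.regularFunctions x = ⊤ := by
  refine eq_top_iff.2 fun g _ ↦ ?_
  obtain ⟨a, b, hb, rfl⟩ := IsFractionRing.div_surjective (A := C.X.presheaf.stalk x) g
  have hb0 : b ≠ 0 := nonZeroDivisors.ne_zero hb
  have hu : IsUnit b := by
    by_contra hc
    have hb1 : b ∈ maximalIdeal (C.X.presheaf.stalk x) := (mem_maximalIdeal b).2 hc
    rw [h] at hb1
    exact hb0 hb1
  obtain ⟨u, rfl⟩ := hu
  refine ⟨a * (u⁻¹ : (C.X.presheaf.stalk x)ˣ), ?_⟩
  have h1 : algebraMap (C.X.presheaf.stalk x) C.K u ≠ 0 := by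
    simp
  change algebraMap _ C.K _ = _
  rw [eq_div_iff h1, ← map_mul, mul_assoc, Units.inv_mul, mul_one]

theorem regularForms_eq_top {x : C.X} (h : maximalIdeal (C.X.presheaf.stalk x) = ⊥) :
    C.regularForms x = ⊤ := by
  refine eq_top_iff.2 fun w _ ↦ ?_
  have hw : w ∈ Submodule.span C.K (Set.range (KaehlerDifferential.D ℂ C.K)) := by
    rw [KaehlerDifferential.span_range_derivation]
    trivial
  induction hw using Submodule.span_induction with
  | mem w hw =>
    obtain ⟨g, rfl⟩ := hw
    exact C.D_mem_regularForms (by rw [C.regularFunctions_eq_top h]; trivial)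
  | zero => exact zero_mem _
  | add w z _ _ h1 h2 => exact add_mem (h1 trivial) (h2 trivial)
  | smul g w _ h1 =>
    exact C.smul_mem_regularForms (by rw [C.regularFunctions_eq_top h]; trivial) (h1 trivial)

theorem algebraMap_ne_zero_or {x : C.X} {t : C.X.presheaf.stalk x}
    (ht : Ideal.span {t} = maximalIdeal (C.X.presheaf.stalk x)) :
    algebraMap (C.X.presheaf.stalk x) C.K t ≠ 0 ∨
      C.regularFunctions x = ⊤ ∧ C.regularForms x = ⊤ := by
  by_cases h : t = 0
  · have hm : maximalIdeal (C.X.presheaf.stalk x) = ⊥ := by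
      rw [← ht, h, Ideal.span_singleton_eq_bot]
    exact Or.inr ⟨C.regularFunctions_eq_top hm, C.regularForms_eq_top hm⟩
  · exact Or.inl ((map_ne_zero_iff _ (IsFractionRing.injective _ _)).2 h)

theorem exists_pole (x : C.X) (g : C.K) : ∃ n : ℕ, g ∈ C.functionsWithPole x n := by
  have := (C.isNoetherianRing_and_isPrincipal x).1
  obtain ⟨a, b, hb, rfl⟩ := IsFractionRing.div_surjective (A := C.X.presheaf.stalk x) g
  have hb0 : b ≠ 0 := nonZeroDivisors.ne_zero hb
  obtain ⟨n, hn⟩ := exists_maximalIdeal_pow_eq_of_principal _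
    (C.isNoetherianRing_and_isPrincipal x).2 (Ideal.span {b})
    (by rwa [Ne, Ideal.span_singleton_eq_bot])
  refine ⟨n, fun t ht ↦ ?_⟩
  have h1 : t ^ n ∈ Ideal.span {b} := by
    rw [hn, ← ht]
    exact Ideal.pow_mem_pow (Ideal.mem_span_singleton_self t) n
  obtain ⟨c, hc⟩ := Ideal.mem_span_singleton.1 h1
  have h2 : algebraMap (C.X.presheaf.stalk x) C.K b ≠ 0 :=
    (map_ne_zero_iff _ (IsFractionRing.injective _ _)).2 hb0
  refine C.mem_regularFunctions.2 ⟨c * a, ?_⟩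
  rw [zpow_natCast, ← map_pow, hc, map_mul, map_mul]
  field_simp

theorem fK_mem (x : C.X) : C.fK ∈ C.functionsWithPole x (C.P x) :=
  Nat.sInf_mem (s := {n : ℕ | C.fK ∈ C.functionsWithPole x n}) (C.exists_pole x C.fK)

theorem P_eq_zero {x : C.X} (hx : x ∈ C.U) : C.P x = 0 := by
  refine Nat.sInf_eq_zero.2 (Or.inl ?_)
  change C.fK ∈ C.functionsWithPole x 0
  rw [functionsWithPole_zero]
  exact C.fK_mem_regularFunctions hx

theorem D_mem_formsWithPole {x : C.X} {n : ℤ} {g : C.K} (hg : g ∈ C.functionsWithPole x n) :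
    KaehlerDifferential.D ℂ C.K g ∈ C.formsWithPole x (n + 1) := by
  intro t ht
  rcases C.algebraMap_ne_zero_or ht with h | h
  · have h0 := hg t ht
    have ht0 : algebraMap (C.X.presheaf.stalk x) C.K t ∈ C.regularFunctions x := ⟨t, rfl⟩
    set s : C.K := algebraMap (C.X.presheaf.stalk x) C.K t
    have h1 := C.smul_mem_regularForms ht0 (C.D_mem_regularForms h0)
    have h2 := C.smul_mem_regularForms h0 (C.D_mem_regularForms ht0)
    have h3 : s ^ (n + 1) • KaehlerDifferential.D ℂ C.K g =
        s • KaehlerDifferential.D ℂ C.K (s ^ n * g) -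
          n • ((s ^ n * g) • KaehlerDifferential.D ℂ C.K s) := by
      rw [Derivation.leibniz, Derivation.leibniz_zpow, zpow_sub_one₀ h, zpow_add_one₀ h,
        smul_add, ← Int.cast_smul_eq_zsmul C.K n, ← Int.cast_smul_eq_zsmul C.K n]
      simp only [smul_smul]
      rw [add_sub_assoc, ← sub_smul]
      have e1 : s * (g * ((n : C.K) * (s ^ n * s⁻¹))) - n * (s ^ n * g) = 0 := by
        field_simp
        ring
      rw [e1, zero_smul, add_zero, mul_comm]
    rw [h3]
    exact sub_mem h1 (zsmul_mem h2 n)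
  · rw [h.2]
    trivial

theorem smul_mem_formsWithPole {x : C.X} {m n : ℤ} {g : C.K} {w : Ω[C.K⁄ℂ]}
    (hg : g ∈ C.functionsWithPole x m) (hw : w ∈ C.formsWithPole x n) :
    g • w ∈ C.formsWithPole x (m + n) := by
  intro t ht
  rcases C.algebraMap_ne_zero_or ht with h | h
  · have h1 := C.smul_mem_regularForms (hg t ht) (hw t ht)
    rw [smul_smul] at h1
    rw [smul_smul, zpow_add₀ h]
    convert h1 using 2
    ring
  · rw [h.2]
    trivial

theorem formsWithPole_mono (x : C.X) {m n : ℤ} (h : m ≤ n) :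
    C.formsWithPole x m ≤ C.formsWithPole x n := by
  intro w hw t ht
  rcases C.algebraMap_ne_zero_or ht with h0 | h0
  · obtain ⟨k, rfl⟩ := Int.le.dest h
    rw [add_comm, zpow_add₀ h0, mul_smul, zpow_natCast, ← map_pow]
    exact C.smul_mem_regularForms ⟨t ^ k, rfl⟩ (hw t ht)
  · rw [h0.2]
    trivial

/-- A subcomplex of sheaves of vector spaces of the twisted meromorphic de Rham complex
`𝒪_X(*S) → Ω¹_X(*S)`, given by its stalks, which are subspaces of the rational functions and of the
rational forms. -/
@[ext]
structure Subcomplex where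
  fn : C.X → Submodule ℂ C.K
  form : C.X → Submodule ℂ Ω[C.K⁄ℂ]
  fn_regular : ∀ x ∈ C.U, fn x ≤ C.regularFunctions x
  form_regular : ∀ x ∈ C.U, form x ≤ C.regularForms x
  nabla_mem : ∀ x, ∀ g ∈ fn x, C.nabla g ∈ form x

namespace Subcomplex
variable {C}

instance : LE C.Subcomplex := ⟨fun A B ↦ (∀ x, A.fn x ≤ B.fn x) ∧ ∀ x, A.form x ≤ B.form x⟩

noncomputable instance : Min C.Subcomplex := ⟨fun A B ↦
  { fn := fun x ↦ A.fn x ⊓ B.fn x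
    form := fun x ↦ A.form x ⊓ B.form x
    fn_regular := fun x hx ↦ inf_le_left.trans (A.fn_regular x hx)
    form_regular := fun x hx ↦ inf_le_left.trans (A.form_regular x hx)
    nabla_mem := fun x g hg ↦ ⟨A.nabla_mem x g hg.1, B.nabla_mem x g hg.2⟩ }⟩

theorem inf_le_left' (A B : C.Subcomplex) : A ⊓ B ≤ A :=
  ⟨fun _ ↦ inf_le_left, fun _ ↦ inf_le_left⟩
end Subcomplex

theorem nabla_mem_regularForms {x : C.X} (hx : x ∈ C.U) {g : C.K}
    (hg : g ∈ C.regularFunctions x) : C.nabla g ∈ C.regularForms x :=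
  add_mem (C.D_mem_regularForms hg)
    (C.smul_mem_regularForms hg (C.D_mem_regularForms (C.fK_mem_regularFunctions hx)))

theorem S_of_mem {x : C.X} (hx : x ∈ C.U) : C.S x = 0 := if_pos hx
theorem S_of_notMem {x : C.X} (hx : x ∉ C.U) : C.S x = 1 := if_neg hx

theorem nabla_mem_formsWithPole {x : C.X} (hx : x ∉ C.U) {n m : ℤ} (h : n + C.S x + C.P x ≤ m)
    {g : C.K} (hg : g ∈ C.functionsWithPole x n) : C.nabla g ∈ C.formsWithPole x m := by
  rw [C.S_of_notMem hx] at h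
  refine add_mem (C.formsWithPole_mono x (by omega) (C.D_mem_formsWithPole hg)) ?_
  exact C.formsWithPole_mono x (by omega)
    (C.smul_mem_formsWithPole hg (C.D_mem_formsWithPole (C.fK_mem x)))

open scoped Classical in
/-- The twisted meromorphic de Rham complex `∇ : 𝒪_X(*S) → Ω¹_X(*S)`: functions and forms that are
regular on `U`, with poles allowed on `S`. -/
noncomputable def meromorphic : C.Subcomplex where
  fn x := if x ∈ C.U then C.regularFunctions x else ⊤
  form x := if x ∈ C.U then C.regularForms x else ⊤
  fn_regular x hx := by rw [if_pos hx]
  form_regular x hx := by rw [if_pos hx]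
  nabla_mem x g hg := by
    by_cases hx : x ∈ C.U
    · rw [if_pos hx] at hg ⊢
      exact C.nabla_mem_regularForms hx hg
    · rw [if_neg hx]
      trivial

theorem Subcomplex.le_meromorphic {C : CompletedCurve} (A : C.Subcomplex) : A ≤ C.meromorphic := by
  refine ⟨fun x ↦ ?_, fun x ↦ ?_⟩
  · by_cases hx : x ∈ C.U
    · simpa [meromorphic, hx] using A.fn_regular x hx
    · simp [meromorphic, hx]
  · by_cases hx : x ∈ C.U
    · simpa [meromorphic, hx] using A.form_regular x hx
    · simp [meromorphic, hx]


/-- The subcomplex `𝒪_X(D) → Ω¹_X(E)`, for divisors `D`, `E` supported on `S` with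
`D + S + P ≤ E`. -/
noncomputable def ofDivisors (D E : C.X → ℤ) (hD : ∀ x ∈ C.U, D x = 0) (hE : ∀ x ∈ C.U, E x = 0)
    (h : ∀ x ∉ C.U, D x + C.S x + C.P x ≤ E x) : C.Subcomplex where
  fn x := C.functionsWithPole x (D x)
  form x := C.formsWithPole x (E x)
  fn_regular x hx := by rw [hD x hx, functionsWithPole_zero]
  form_regular x hx := by rw [hE x hx, formsWithPole_zero]
  nabla_mem x g hg := by
    by_cases hx : x ∈ C.U
    · rw [hD x hx, functionsWithPole_zero] at hg
      rw [hE x hx, formsWithPole_zero]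
      exact C.nabla_mem_regularForms hx hg
    · exact C.nabla_mem_formsWithPole hx (h x hx) hg

/-- The part of degree `≥ k` of a complex in degrees `0` and `1`. -/
noncomputable def Subcomplex.truncGE {C : CompletedCurve} (A : C.Subcomplex) (k : ℤ) :
    C.Subcomplex where
  fn x := if k ≤ 0 then A.fn x else ⊥
  form x := if k ≤ 1 then A.form x else ⊥
  fn_regular x hx := by
    split_ifs
    exacts [A.fn_regular x hx, bot_le]
  form_regular x hx := by
    split_ifs
    exacts [A.form_regular x hx, bot_le]
  nabla_mem x g hg := by
    by_cases hk : k ≤ 0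
    · rw [if_pos hk] at hg
      rw [if_pos (by omega)]
      exact A.nabla_mem x g hg
    · rw [if_neg hk, Submodule.mem_bot] at hg
      rw [hg, map_zero]
      exact zero_mem _

/-- The divisor `⌊-rP⌋`. -/
noncomputable def fnDivisor (r : ℝ) (x : C.X) : ℤ := ⌊-r * (C.P x : ℝ)⌋

/-- The divisor `S + ⌊(1 - r)P⌋`. -/
noncomputable def formDivisor (r : ℝ) (x : C.X) : ℤ := C.S x + ⌊(1 - r) * (C.P x : ℝ)⌋

/-- The complex `𝒪(⌊-rP⌋) → Ω¹(log S)(⌊(1 - r)P⌋)` with differential `∇`. On a curve, `Ω¹(log S)`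
is `Ω¹(S)`. -/
noncomputable def twistedLogComplex (r : ℝ) : C.Subcomplex :=
  C.ofDivisors (C.fnDivisor r) (C.formDivisor r)
    (fun x hx ↦ by simp [fnDivisor, C.P_eq_zero hx])
    (fun x hx ↦ by simp [formDivisor, C.P_eq_zero hx, C.S_of_mem hx])
    (fun x _ ↦ by
      rw [fnDivisor, formDivisor]
      have h : (1 - r) * (C.P x : ℝ) = -r * C.P x + C.P x := by ring
      rw [h, Int.floor_add_natCast]
      omega)

/-- The irregular Hodge filtration `F^r(∇)`: the part of degree `≥ ⌈r⌉` of
`𝒪(⌊-rP⌋) → Ω¹(log S)(⌊(1 - r)P⌋)`. -/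
noncomputable def irrHodge (r : ℝ) : C.Subcomplex := (C.twistedLogComplex r).truncGE ⌈r⌉

/-- The divisor of `𝔉^r 𝒪_X(*S)` for `r ≤ 0`: it is `S - ⌈rP⌉` if `-1 < r ≤ 0`, and for `r ≤ -1`
it is obtained from that of `r + 1` by adding `S + P`. -/
noncomputable def deligneDivisor (r : ℝ) (x : C.X) : ℤ :=
  if -1 < r then C.S x - ⌈r * C.P x⌉ else deligneDivisor (r + 1) x + (C.S x + C.P x)
termination_by ⌈-r⌉₊
decreasing_by
  have h : -r = -(r + 1) + 1 := by ring
  rw [h, Nat.ceil_add_one (by linarith)]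
  exact Nat.lt_succ_self _

theorem deligneDivisor_of_le (r : ℝ) (hr : r ≤ -1) (x : C.X) :
    C.deligneDivisor r x = C.deligneDivisor (r + 1) x + (C.S x + C.P x) := by
  rw [deligneDivisor, if_neg (not_lt.2 hr)]

theorem deligneDivisor_of_mem (r : ℝ) {x : C.X} (hx : x ∈ C.U) : C.deligneDivisor r x = 0 := by
  fun_induction deligneDivisor C r x with
  | case1 => simp [C.P_eq_zero hx, C.S_of_mem hx]
  | case2 r hr ih => simp [ih, C.P_eq_zero hx, C.S_of_mem hx]

/-- Deligne's filtration `𝔉^r` on the twisted meromorphic de Rham complex. The sheaf of forms in it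
is `𝔉^r Ω¹(*S) = Ω¹ ⊗ 𝔉^{r-1} 𝒪(*S)`. -/
noncomputable def deligne (r : ℝ) : C.Subcomplex where
  fn x := if 0 < r then ⊥ else C.functionsWithPole x (C.deligneDivisor r x)
  form x := if 0 < r - 1 then ⊥ else C.formsWithPole x (C.deligneDivisor (r - 1) x)
  fn_regular x hx := by
    split_ifs
    · exact bot_le
    · rw [C.deligneDivisor_of_mem _ hx, functionsWithPole_zero]
  form_regular x hx := by
    split_ifs
    · exact bot_le
    · rw [C.deligneDivisor_of_mem _ hx, formsWithPole_zero]
  nabla_mem x g hg := by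
    by_cases hr : 0 < r
    · rw [if_pos hr, Submodule.mem_bot] at hg
      rw [hg, map_zero]
      exact zero_mem _
    · rw [if_neg hr] at hg
      rw [if_neg (by linarith)]
      by_cases hx : x ∈ C.U
      · rw [C.deligneDivisor_of_mem _ hx, functionsWithPole_zero] at hg
        rw [C.deligneDivisor_of_mem _ hx, formsWithPole_zero]
        exact C.nabla_mem_regularForms hx hg
      · refine C.nabla_mem_formsWithPole hx (le_of_eq ?_) hg
        rw [C.deligneDivisor_of_le (r - 1) (by linarith), sub_add_cancel, add_assoc]

/-- The logarithmic complex of the irregular Hodge filtration: `F^0(∇)` twisted by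
`𝒪(-P_red)`. -/
noncomputable def logComplex : C.Subcomplex :=
  C.ofDivisors (fun x ↦ C.fnDivisor 0 x - C.Pred x) (fun x ↦ C.formDivisor 0 x - C.Pred x)
    (fun x hx ↦ by simp [fnDivisor, C.P_eq_zero hx, Pred])
    (fun x hx ↦ by simp [formDivisor, C.P_eq_zero hx, C.S_of_mem hx, Pred])
    (fun x _ ↦ by simp [fnDivisor, formDivisor]; omega)

/-- The logarithmic complex of Deligne's filtration `𝔉`: the complex
`ker (𝔉^0 𝒪(*S) → Gr^0 Ω¹(*S)) → 𝔉^{0+} Ω¹(*S)`, where `𝔉^{0+}` is the union of the `𝔉^r` for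
`r > 0` and `Gr^0 = 𝔉^0 / 𝔉^{0+}`. -/
noncomputable def deligneLogComplex : C.Subcomplex where
  fn x := (C.deligne 0).fn x ⊓ (⨆ r : Set.Ioi (0 : ℝ), (C.deligne r).form x).comap C.nabla
  form x := ⨆ r : Set.Ioi (0 : ℝ), (C.deligne r).form x
  fn_regular x hx := inf_le_left.trans ((C.deligne 0).fn_regular x hx)
  form_regular x hx := iSup_le fun r ↦ (C.deligne r).form_regular x hx
  nabla_mem _ _ hg := hg.2

end CompletedCurve

section Sheaves

/-- Sheaves of complex vector spaces on `Y`. -/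
abbrev Sh (Y : TopCat.{0}) := Sheaf (Opens.grothendieckTopology Y) (ModuleCat.{0} ℂ)

variable {Y : TopCat.{0}} {M N : Type} [AddCommGroup M] [Module ℂ M] [AddCommGroup N] [Module ℂ N]

/-- Sections over `V`: locally constant `M`-valued functions on `V`, with value in `A x` at `x`. -/
def sectionsOf (A : Y → Submodule ℂ M) (V : Opens Y) : Submodule ℂ (V → M) where
  carrier := {s | IsLocallyConstant s ∧ ∀ x : V, s x ∈ A x}
  add_mem' hs ht := ⟨hs.1.add ht.1, fun x ↦ add_mem (hs.2 x) (ht.2 x)⟩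
  zero_mem' := ⟨IsLocallyConstant.const 0, fun _ ↦ zero_mem _⟩
  smul_mem' c _ hs := ⟨hs.1.comp (c • ·), fun x ↦ Submodule.smul_mem _ c (hs.2 x)⟩

/-- The presheaf of the sections above. -/
def presheafOf (A : Y → Submodule ℂ M) : TopCat.Presheaf (ModuleCat.{0} ℂ) Y where
  obj V := ModuleCat.of ℂ (sectionsOf A V.unop)
  map i := ModuleCat.ofHom
    { toFun s := ⟨fun x ↦ s.1 (i.unop x),
        s.2.1.comp_continuous (continuous_inclusion (leOfHom i.unop)), fun x ↦ s.2.2 (i.unop x)⟩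
      map_add' _ _ := rfl
      map_smul' _ _ := rfl }
  map_id _ := rfl
  map_comp _ _ := rfl

theorem isSheaf_presheafOf (A : Y → Submodule ℂ M) : (presheafOf A).IsSheaf := by
  rw [TopCat.Presheaf.isSheaf_iff_isSheaf_comp (forget (ModuleCat.{0} ℂ))]
  apply TopCat.Presheaf.isSheaf_of_isSheafUniqueGluing_types
  intro ι V sf hsf
  have hcompat : ∀ (i j : ι) (x : Y) (hi : x ∈ V i) (hj : x ∈ V j),
      (sf i).1 ⟨x, hi⟩ = (sf j).1 ⟨x, hj⟩ := by
    intro i j x hi hj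
    exact congrFun (congrArg Subtype.val (hsf i j)) ⟨x, hi, hj⟩
  have hmem : ∀ x : (iSup V : Opens Y), ∃ i, x.1 ∈ V i := fun x ↦ Opens.mem_iSup.1 x.2
  choose k hk using hmem
  have hval : ∀ (x : (iSup V : Opens Y)) (i : ι) (hi : x.1 ∈ V i),
      (sf (k x)).1 ⟨x.1, hk x⟩ = (sf i).1 ⟨x.1, hi⟩ := fun x i hi ↦ hcompat _ _ _ _ _
  refine ⟨⟨fun x ↦ (sf (k x)).1 ⟨x.1, hk x⟩, ?_, fun x ↦ (sf (k x)).2.2 ⟨x.1, hk x⟩⟩, ?_, ?_⟩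
  · rw [IsLocallyConstant.iff_eventually_eq]
    intro x
    have h1 := (IsLocallyConstant.iff_eventually_eq _).1 (sf (k x)).2.1 ⟨x.1, hk x⟩
    rw [nhds_subtype_eq_comap, Filter.eventually_comap] at h1 ⊢
    filter_upwards [h1, (V (k x)).isOpen.mem_nhds (hk x)] with y hy hyV z hz
    subst hz
    rw [hval z (k x) hyV]
    exact hy ⟨z.1, hyV⟩ rfl
  · intro i
    refine Subtype.ext (funext fun x ↦ ?_)
    exact hval _ i x.2
  · intro t ht
    refine Subtype.ext (funext fun x ↦ ?_)
    exact congrFun (congrArg Subtype.val (ht (k x))) ⟨x.1, hk x⟩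

/-- The subsheaf of the constant sheaf `M` whose sections have their germ at `x` in `A x`. -/
def sheafOf (A : Y → Submodule ℂ M) : Sh Y := ⟨presheafOf A, isSheaf_presheafOf A⟩

/-- The morphism of sheaves induced by a linear map. -/
def sheafMap {A : Y → Submodule ℂ M} {B : Y → Submodule ℂ N} (φ : M →ₗ[ℂ] N)
    (h : ∀ x, ∀ m ∈ A x, φ m ∈ B x) : sheafOf A ⟶ sheafOf B :=
  ⟨{ app V := ModuleCat.ofHom
      { toFun s := ⟨fun x ↦ φ (s.1 x), s.2.1.comp φ, fun x ↦ h x _ (s.2.2 x)⟩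
        map_add' s t := Subtype.ext (funext fun x ↦ map_add φ (s.1 x) (t.1 x))
        map_smul' c s := Subtype.ext (funext fun x ↦ map_smul φ c (s.1 x)) } }⟩

noncomputable instance (Y : TopCat.{0}) : HasDerivedCategory (Sh Y) :=
  HasDerivedCategory.standard _

/-- The sheaf `ℂ_V` that represents sections over `V` (extension by zero of the constant sheaf). -/
noncomputable def freeSheaf (V : Opens Y) : Sh Y :=
  (presheafToSheaf _ _).obj (yoneda.obj V ⋙ ModuleCat.free ℂ)

/-- The inclusion `ℂ_W → ℂ_V` for `W ⊆ V`. -/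
noncomputable def freeSheafMap {V W : Opens Y} (h : W ≤ V) : freeSheaf W ⟶ freeSheaf V :=
  (presheafToSheaf _ _).map (Functor.whiskerRight (yoneda.map (homOfLE h)) (ModuleCat.free ℂ))

/-- Hypercohomology `ℍ^i(V, L) = Hom_D(ℂ_V, L[i])`, a group of morphisms in the derived category of
sheaves of complex vector spaces. -/
abbrev Hyper (V : Opens Y) (L : CochainComplex (Sh Y) ℤ) (i : ℤ) : Type _ :=
  (DerivedCategory.singleFunctor (Sh Y) 0).obj (freeSheaf V) ⟶ (DerivedCategory.Q.obj L)⟦i⟧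

/-- Functoriality of hypercohomology in the complex. -/
noncomputable def Hyper.map (V : Opens Y) {L L' : CochainComplex (Sh Y) ℤ} (φ : L ⟶ L') (i : ℤ) :
    Hyper V L i →ₗ[ℂ] Hyper V L' i :=
  Linear.rightComp ℂ _ ((DerivedCategory.Q.map φ)⟦i⟧')

/-- Restriction of hypercohomology to a smaller open set. -/
noncomputable def Hyper.res {V W : Opens Y} (h : W ≤ V) (L : CochainComplex (Sh Y) ℤ) (i : ℤ) :
    Hyper V L i →ₗ[ℂ] Hyper W L i :=
  Linear.leftComp ℂ _ ((DerivedCategory.singleFunctor (Sh Y) 0).map (freeSheafMap h))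

end Sheaves

namespace CompletedCurve
variable {C : CompletedCurve}

/-- The complex of sheaves on `X`, in degrees `0` and `1`. -/
noncomputable def Subcomplex.cx (A : C.Subcomplex) : CochainComplex (Sh C.X.carrier) ℤ :=
  HomologicalComplex.double (sheafMap C.nabla A.nabla_mem)
    (show (ComplexShape.up ℤ).Rel 0 1 from rfl)

/-- The morphism of complexes of sheaves given by an inclusion. -/
noncomputable def Subcomplex.incl {A B : C.Subcomplex} (h : A ≤ B) : A.cx ⟶ B.cx :=
  HomologicalComplex.mkHomFromDouble _ zero_ne_one
    (sheafMap LinearMap.id h.1 ≫ (HomologicalComplex.doubleXIso₀ _ _).inv)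
    (sheafMap LinearMap.id h.2 ≫ (HomologicalComplex.doubleXIso₁ _ _ zero_ne_one).inv)
    (by
      simp [Subcomplex.cx, HomologicalComplex.double_d _ _ (zero_ne_one' ℤ)]
      rfl)
    (fun k hk ↦ by
      exact ((HomologicalComplex.isZero_double_X _ _ k (by simp at hk; omega)
        (by simp at hk; omega)).eq_of_tgt _ _))

/-- The de Rham cohomology `H_dR^i(U, ∇)`: hypercohomology on `U` of the twisted de Rham complex. The
twisted meromorphic de Rham complex of `X` restricts on `U` to the complex of regular forms. -/
abbrev HdR (C : CompletedCurve) (i : ℤ) : Type _ := Hyper C.U C.meromorphic.cx i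

/-- The map `ℍ^i(X, A) → ℍ^i(X, Ω•_X(*S)) → H_dR^i(U, ∇)`; its second part is the restriction to `U`. -/
noncomputable def Subcomplex.toHdR (A : C.Subcomplex) (i : ℤ) :
    Hyper (⊤ : Opens C.X.carrier) A.cx i →ₗ[ℂ] C.HdR i :=
  Hyper.res le_top C.meromorphic.cx i ∘ₗ Hyper.map ⊤ (incl A.le_meromorphic) i

/-- The filtration on `H_dR^i(U, ∇)` induced by a filtration `G` of the twisted meromorphic de Rham
complex: the image of the hypercohomology of `G^r`. -/
noncomputable def inducedFiltration (G : ℝ → C.Subcomplex) (r : ℝ) (i : ℤ) : Submodule ℂ (C.HdR i) :=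
  LinearMap.range ((G r).toHdR i)

/-- With the induced filtration `G^r ∩ L`, the inclusion of `L` in the twisted meromorphic de Rham
complex filtered by `G` is a filtered quasi-isomorphism: it is a quasi-isomorphism, also on every
step of the filtrations. -/
def IsFilteredQuasiIso (L : C.Subcomplex) (G : ℝ → C.Subcomplex) : Prop :=
  QuasiIso (Subcomplex.incl L.le_meromorphic) ∧
    ∀ r : ℝ, QuasiIso (Subcomplex.incl (Subcomplex.inf_le_left' (G r) L))
end CompletedCurve

end IrregularHodge

/-!
The two logarithmic complexes, and all inclusions in question, are determined by the stalks, and at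
a point `x` of `S` everything follows from one computation. Let `t` be a uniformizer at `x`. Since
`X` is smooth of dimension one, `dt` generates `Ω¹` at `x` and does not vanish among the rational
forms. If `f` has a pole of order `P > 0`, then `df` is a unit times `t ^ (-P - 1) dt`, hence
`∇ (t ^ (-n) a)` is, up to lower order terms, `t ^ (-n - P - 1) dt` times a unit times `a`. If
`P = 0`, the same holds with the unit `-n`, as long as `n ≠ 0`. This is
`CompletedCurve.exists_leading_term`. Thus `∇` maps the functions with poles of order `n` modulo those
of order `n - 1` bijectively to the forms with poles of order `n + P + 1` modulo those of order
`n + P`, for all `n > -P_red`; by induction on pole orders it is a bijection from the functions modulo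
`𝒪(-P_red)` to the forms modulo `Ω¹(log S)(P - P_red)`
(`CompletedCurve.mem_functionsWithPole_neg_Pred`, `CompletedCurve.exists_sub_nabla_mem_log`).

The forms in `𝔉^{0+}` are those of `Ω¹(log S)(P - P_red)`, so injectivity identifies the functions
of the logarithmic complex of `𝔉` as `𝒪(-P_red)`. For `r > 0` the two filtrations agree and consist
of forms of the logarithmic complex; for `r ≤ 0` both contain it. This gives the
equality of filtered complexes.

For the quasi-isomorphisms, `CompletedCurve.quasiIso_incl` reduces the claim for an inclusion of
subcomplexes to the bijectivity of `∇` on the quotients of the stalks. Passing from germs to sections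
uses that `S` is discrete and that a rational function is regular in a punctured neighbourhood of any
point (`CompletedCurve.exists_nhd_regularFunctions`).

Finally, both `F^r` and `𝔉^r` are quasi-isomorphic to the same subcomplex, their intersection with
the logarithmic complex, so their hypercohomologies have the same image.
-/

namespace IrregularHodge

/-! ### Quasi-isomorphisms between two-term complexes -/

/-- A morphism between complexes in degrees `0` and `1` is a quasi-isomorphism if it is a
monomorphism, its square is cartesian, and `L⁰` and `K¹` together cover `L¹`. -/
theorem quasiIso_of_cartesian_of_epi {𝒜 : Type*} [Category 𝒜] [Abelian 𝒜]
    {K L : CochainComplex 𝒜 ℤ} (φ : K ⟶ L)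
    (hK : ∀ n, n ≠ 0 → n ≠ 1 → Limits.IsZero (K.X n))
    (hL : ∀ n, n ≠ 0 → n ≠ 1 → Limits.IsZero (L.X n))
    [Mono (φ.f 0)] [Mono (φ.f 1)]
    (hlift : ∀ ⦃T : 𝒜⦄ (y : T ⟶ L.X 0) (x : T ⟶ K.X 1),
      y ≫ L.d 0 1 = x ≫ φ.f 1 → ∃ z : T ⟶ K.X 0, z ≫ φ.f 0 = y)
    {Z : 𝒜} (p : Z ⟶ L.X 0) (q : Z ⟶ K.X 1) (hepi : Epi (p ≫ L.d 0 1 + q ≫ φ.f 1)) :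
    QuasiIso φ := by
  rw [quasiIso_iff]
  intro n
  by_cases h0 : n = 0
  · subst h0
    rw [quasiIsoAt_iff_isIso_homologyMap]
    have : Mono (HomologicalComplex.homologyMap φ 0) := by
      rw [HomologicalComplex.mono_homologyMap_iff_up_to_refinements φ (-1) 0 1 (by simp) (by simp)]
      intro A x₂ _ y₁ h
      rw [(hL (-1) (by simp) (by simp)).eq_of_tgt y₁ 0, Limits.zero_comp] at h
      rw [Limits.zero_of_comp_mono _ h]
      exact ⟨A, 𝟙 _, inferInstance, 0, by simp⟩
    have : Epi (HomologicalComplex.homologyMap φ 0) := by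
      rw [HomologicalComplex.epi_homologyMap_iff_up_to_refinements φ (-1) 0 1 (by simp) (by simp)]
      intro A y₂ h
      obtain ⟨z, hz⟩ := hlift y₂ 0 (by simp [h])
      refine ⟨A, 𝟙 _, inferInstance, z, ?_, 0, by simp [hz]⟩
      rw [← cancel_mono (φ.f 1), Category.assoc, ← φ.comm, reassoc_of% hz, h, Limits.zero_comp]
    exact isIso_of_mono_of_epi _
  by_cases h1 : n = 1
  · subst h1
    rw [quasiIsoAt_iff_isIso_homologyMap]
    have : Mono (HomologicalComplex.homologyMap φ 1) := by
      rw [HomologicalComplex.mono_homologyMap_iff_up_to_refinements φ 0 1 2 (by simp) (by simp)]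
      intro A x₂ _ y₁ h
      obtain ⟨z, hz⟩ := hlift y₁ x₂ h.symm
      refine ⟨A, 𝟙 _, inferInstance, z, ?_⟩
      rw [← cancel_mono (φ.f 1), Category.id_comp, h, Category.assoc, ← φ.comm, reassoc_of% hz]
    have : Epi (HomologicalComplex.homologyMap φ 1) := by
      rw [HomologicalComplex.epi_homologyMap_iff_up_to_refinements φ 0 1 2 (by simp) (by simp)]
      intro A y₂ _
      obtain ⟨A', π, hπ, z, hz⟩ := surjective_up_to_refinements_of_epi
        (p ≫ L.d 0 1 + q ≫ φ.f 1) y₂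
      refine ⟨A', π, hπ, z ≫ q, (hK 2 (by simp) (by simp)).eq_of_tgt _ _, z ≫ p, ?_⟩
      rw [hz, Preadditive.comp_add, add_comm]
      simp
    exact isIso_of_mono_of_epi _
  · rw [quasiIsoAt_iff_exactAt]
    · exact ShortComplex.exact_of_isZero_X₂ _ (hL n h0 h1)
    · exact ShortComplex.exact_of_isZero_X₂ _ (hK n h0 h1)

/-- The criterion `quasiIso_of_cartesian_of_epi` in terms of the square itself. -/
theorem quasiIso_double {𝒜 : Type*} [Category 𝒜] [Abelian 𝒜] {X₀ X₁ Y₀ Y₁ : 𝒜}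
    (f : X₀ ⟶ X₁) (g : Y₀ ⟶ Y₁) (a : X₀ ⟶ Y₀) (b : X₁ ⟶ Y₁) [Mono a] [Mono b]
    (hr : (ComplexShape.up ℤ).Rel 0 1)
    (φ : HomologicalComplex.double f hr ⟶ HomologicalComplex.double g hr)
    (h0 : φ.f 0 = (HomologicalComplex.doubleXIso₀ f hr).hom ≫ a ≫
      (HomologicalComplex.doubleXIso₀ g hr).inv)
    (h1 : φ.f 1 = (HomologicalComplex.doubleXIso₁ f hr zero_ne_one).hom ≫ b ≫
      (HomologicalComplex.doubleXIso₁ g hr zero_ne_one).inv)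
    (hlift : ∀ ⦃T : 𝒜⦄ (y : T ⟶ Y₀) (x : T ⟶ X₁), y ≫ g = x ≫ b → ∃ z : T ⟶ X₀, z ≫ a = y)
    {Z : 𝒜} (p : Z ⟶ Y₀) (q : Z ⟶ X₁) (hepi : Epi (p ≫ g + q ≫ b)) :
    QuasiIso φ := by
  have : Mono (φ.f 0) := by rw [h0]; infer_instance
  have : Mono (φ.f 1) := by rw [h1]; infer_instance
  refine quasiIso_of_cartesian_of_epi φ
    (fun n h0 h1 ↦ HomologicalComplex.isZero_double_X _ _ n h0 h1)
    (fun n h0 h1 ↦ HomologicalComplex.isZero_double_X _ _ n h0 h1) ?_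
    (p ≫ (HomologicalComplex.doubleXIso₀ _ _).inv)
    (q ≫ (HomologicalComplex.doubleXIso₁ _ _ zero_ne_one).inv) ?_
  · intro T y x hyx
    obtain ⟨u, hu⟩ := hlift (y ≫ (HomologicalComplex.doubleXIso₀ g hr).hom)
      (x ≫ (HomologicalComplex.doubleXIso₁ f hr zero_ne_one).hom) (by
        rw [h1, HomologicalComplex.double_d _ _ zero_ne_one] at hyx
        rw [← cancel_mono (HomologicalComplex.doubleXIso₁ g hr zero_ne_one).inv]
        simpa using hyx)
    refine ⟨u ≫ (HomologicalComplex.doubleXIso₀ _ _).inv, ?_⟩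
    rw [h0, Category.assoc, Iso.inv_hom_id_assoc, reassoc_of% hu, Iso.hom_inv_id,
      Category.comp_id]
  · have he : (p ≫ (HomologicalComplex.doubleXIso₀ g hr).inv) ≫
          (HomologicalComplex.double g hr).d 0 1 +
        (q ≫ (HomologicalComplex.doubleXIso₁ f hr zero_ne_one).inv) ≫ φ.f 1 =
        (p ≫ g + q ≫ b) ≫ (HomologicalComplex.doubleXIso₁ g hr zero_ne_one).inv := by
      simp [h1, HomologicalComplex.double_d _ _ (zero_ne_one' ℤ)]
    rw [he]
    infer_instance

/-- Composition of morphisms between two-term complexes is componentwise. -/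
theorem double_comp_eq {𝒜 : Type*} [Category 𝒜] [Abelian 𝒜] {X₀ X₁ Y₀ Y₁ Z₀ Z₁ : 𝒜}
    (f : X₀ ⟶ X₁) (g : Y₀ ⟶ Y₁) (h : Z₀ ⟶ Z₁) (hr : (ComplexShape.up ℤ).Rel 0 1)
    (φ : HomologicalComplex.double f hr ⟶ HomologicalComplex.double g hr)
    (ψ : HomologicalComplex.double g hr ⟶ HomologicalComplex.double h hr)
    (χ : HomologicalComplex.double f hr ⟶ HomologicalComplex.double h hr)
    {a₀ : X₀ ⟶ Y₀} {a₁ : X₁ ⟶ Y₁} {b₀ : Y₀ ⟶ Z₀} {b₁ : Y₁ ⟶ Z₁} {c₀ : X₀ ⟶ Z₀} {c₁ : X₁ ⟶ Z₁}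
    (hφ₀ : φ.f 0 = (HomologicalComplex.doubleXIso₀ f hr).hom ≫ a₀ ≫
      (HomologicalComplex.doubleXIso₀ g hr).inv)
    (hφ₁ : φ.f 1 = (HomologicalComplex.doubleXIso₁ f hr zero_ne_one).hom ≫ a₁ ≫
      (HomologicalComplex.doubleXIso₁ g hr zero_ne_one).inv)
    (hψ₀ : ψ.f 0 = (HomologicalComplex.doubleXIso₀ g hr).hom ≫ b₀ ≫
      (HomologicalComplex.doubleXIso₀ h hr).inv)
    (hψ₁ : ψ.f 1 = (HomologicalComplex.doubleXIso₁ g hr zero_ne_one).hom ≫ b₁ ≫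
      (HomologicalComplex.doubleXIso₁ h hr zero_ne_one).inv)
    (hχ₀ : χ.f 0 = (HomologicalComplex.doubleXIso₀ f hr).hom ≫ c₀ ≫
      (HomologicalComplex.doubleXIso₀ h hr).inv)
    (hχ₁ : χ.f 1 = (HomologicalComplex.doubleXIso₁ f hr zero_ne_one).hom ≫ c₁ ≫
      (HomologicalComplex.doubleXIso₁ h hr zero_ne_one).inv)
    (h₀ : a₀ ≫ b₀ = c₀) (h₁ : a₁ ≫ b₁ = c₁) : φ ≫ ψ = χ := by
  subst h₀ h₁
  refine HomologicalComplex.from_double_hom_ext ?_ ?_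
  · simp [hφ₀, hψ₀, hχ₀]
  · simp [hφ₁, hψ₁, hχ₁]

/-! ### Sheaves of germs and their morphisms -/

section Sheaves
variable {Y : TopCat.{0}} {M N : Type} [AddCommGroup M] [Module ℂ M] [AddCommGroup N] [Module ℂ N]

/-- The map on sections over `V` of a morphism into `sheafOf B`. -/
def onSections {B : Y → Submodule ℂ M} {T : Sh Y} (y : T ⟶ sheafOf B) (V : (Opens Y)ᵒᵖ) :
    T.obj.obj V →ₗ[ℂ] sectionsOf B V.unop :=
  (y.hom.app V).hom

/-- The sections of `sheafOf A` are functions, so a morphism into `sheafOf B` factors through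
`sheafOf A` as soon as the values of its sections lie in `A`. -/
theorem exists_lift_sheafMap_id {A B : Y → Submodule ℂ M} (h : ∀ x, ∀ m ∈ A x, m ∈ B x)
    {T : Sh Y} (y : T ⟶ sheafOf B)
    (hy : ∀ V t (x : V.unop), (onSections y V t).1 x ∈ A x) :
    ∃ z : T ⟶ sheafOf A, z ≫ sheafMap LinearMap.id h = y := by
  refine ⟨⟨{
    app V := ModuleCat.ofHom
      { toFun t := ⟨(onSections y V t).1, (onSections y V t).2.1, hy V t⟩
        map_add' s t := Subtype.ext (p := (· ∈ sectionsOf A V.unop))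
          (congrArg (fun u : sectionsOf B V.unop ↦ u.1) (map_add (onSections y V) s t))
        map_smul' c s := Subtype.ext (p := (· ∈ sectionsOf A V.unop))
          (congrArg (fun u : sectionsOf B V.unop ↦ u.1) (map_smul (onSections y V) c s)) }
    naturality V W i := ?_ }⟩, ?_⟩
  · ext t
    have := congrArg (fun g ↦ g.hom t) (y.hom.naturality i)
    exact Subtype.ext (p := (· ∈ sectionsOf A W.unop))
      (congrArg (fun u : sectionsOf B W.unop ↦ u.1) this)
  · rfl

instance mono_sheafMap_id {A B : Y → Submodule ℂ M} (h : ∀ x, ∀ m ∈ A x, m ∈ B x) :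
    Mono (sheafMap (Y := Y) LinearMap.id h) := by
  constructor
  intro T y z hyz
  ext V t
  have := congrArg (fun g ↦ (onSections g V t).1) hyz
  exact Subtype.ext (p := (· ∈ sectionsOf A V.unop)) this

/-- A linear map induces an epimorphism of sheaves if each value of the target lifts to a value
which is allowed on a whole neighbourhood. -/
theorem epi_sheafMap {A : Y → Submodule ℂ M} {B : Y → Submodule ℂ N} (φ : M →ₗ[ℂ] N)
    (h : ∀ x, ∀ m ∈ A x, φ m ∈ B x)
    (hsurj : ∀ (V : Opens Y) (n : N), (∀ y ∈ V, n ∈ B y) → ∀ x ∈ V,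
      ∃ m, φ m = n ∧ ∃ W : Opens Y, x ∈ W ∧ ∀ y ∈ W, y ∈ V → m ∈ A y) :
    Epi (sheafMap (Y := Y) φ h) := by
  refine (CategoryTheory.Sheaf.isLocallySurjective_iff_epi' (φ := sheafMap φ h)).1 <|
    (TopCat.Presheaf.isLocallySurjective_iff _).2 ?_
  intro V (s : sectionsOf B V) x hx
  obtain ⟨O, hO, hxO, hs⟩ := (IsLocallyConstant.iff_exists_open _).1 s.2.1 ⟨x, hx⟩
  obtain ⟨O', hO', rfl⟩ := isOpen_induced_iff.1 hO
  obtain ⟨m, hm, W, hxW, hW⟩ := hsurj (V ⊓ ⟨O', hO'⟩) (s.1 ⟨x, hx⟩)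
    (fun y hy ↦ hs ⟨y, hy.1⟩ hy.2 ▸ s.2.2 ⟨y, hy.1⟩) x ⟨hx, hxO⟩
  let V' : Opens Y := V ⊓ ⟨O', hO'⟩ ⊓ W
  let s' : sectionsOf A V' :=
    ⟨fun _ ↦ m, IsLocallyConstant.const _, fun y ↦ hW y y.2.2 y.2.1⟩
  refine ⟨V', inf_le_left.trans inf_le_left, ⟨s', ?_⟩, ⟨⟨hx, hxO⟩, hxW⟩⟩
  · refine Subtype.ext (p := (· ∈ sectionsOf B V')) (funext fun y ↦ ?_)
    exact hm.trans (hs ⟨y.1, y.2.1.1⟩ y.2.1.2).symm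

end Sheaves

namespace CompletedCurve
variable (C : CompletedCurve)

/-! ### Topology of the curve, and spreading out of rational functions -/

theorem noetherianSpace : NoetherianSpace C.X :=
  have : IsNoetherian C.X :=
    { LocallyOfFiniteType.isLocallyNoetherian C.str,
      QuasiCompact.compactSpace_of_compactSpace C.str with }
  inferInstance

/-- The local rings have dimension at most one, so a point has no generalizations besides itself
and the generic point. -/
theorem eq_of_specializes {z x : C.X} (h : z ⤳ x) (hz : z ≠ genericPoint C.X) : z = x := by
  have h4 := (C.isNoetherianRing_and_isPrincipal x).1
  have h5 := (tfae_of_isNoetherianRing_of_isLocalRing_of_isDomain (C.X.presheaf.stalk x)).out 4 3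
  have hprime : ∀ P : Ideal (C.X.presheaf.stalk x), P ≠ ⊥ → P.IsPrime → P = maximalIdeal _ :=
    (h5.1 (C.isNoetherianRing_and_isPrincipal x).2).2
  have hrange (y : C.X) (hy : y ⤳ x) : ∃ p, C.X.fromSpecStalk x p = y := by
    have : y ∈ Set.range (C.X.fromSpecStalk x) := by rwa [Scheme.range_fromSpecStalk]
    exact this
  obtain ⟨p, rfl⟩ := hrange z h
  obtain ⟨q, hq⟩ := hrange _ ((genericPoint_spec C.X).specializes trivial : genericPoint C.X ⤳ x)
  by_cases hp : p.asIdeal = ⊥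
  · refine absurd ?_ hz
    have hpq : p ⤳ q := (PrimeSpectrum.le_iff_specializes _ _).1
      (show p.asIdeal ≤ q.asIdeal from hp ▸ bot_le)
    have h1 := hpq.map (C.X.fromSpecStalk x).continuous
    rw [hq] at h1
    exact (h1.antisymm ((genericPoint_spec C.X).specializes trivial)).eq
  · have : p = closedPoint _ := PrimeSpectrum.ext (hprime _ hp p.2)
    rw [this, Scheme.fromSpecStalk_closedPoint]

/-- The complement of a nonempty open set is discrete. -/
theorem exists_punctured_nhd_le (W : C.X.Opens) [hW : Nonempty W] (x : C.X) :
    ∃ V : C.X.Opens, x ∈ V ∧ ∀ y ∈ V, y ≠ x → y ∈ W := by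
  have := C.noetherianSpace
  obtain ⟨S, hS, hSc, hSi, hSU⟩ :=
    NoetherianSpace.exists_finite_set_isClosed_irreducible W.isOpen.isClosed_compl
  have hη : genericPoint C.X ∈ W :=
    (genericPoint_spec C.X).mem_open_set_iff W.isOpen |>.2 (by
      obtain ⟨w⟩ := hW
      exact ⟨w.1, trivial, w.2⟩)
  -- the generic point of each component of the complement specializes to all points of the
  -- component, and is not the generic point of `X`
  have hsub : ∀ T ∈ S, T.Subsingleton := by
    intro T hT
    obtain ⟨z, hz⟩ := QuasiSober.sober (hSi T hT) (hSc T hT)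
    have hzT : z ∉ (W : Set C.X) := by
      have : z ∈ ⋃₀ S := ⟨T, hT, hz.mem⟩
      rwa [← hSU] at this
    have h1 : ∀ y ∈ T, z = y := fun y hy ↦
      C.eq_of_specializes (hz.specializes hy) fun h ↦ hzT (h ▸ hη)
    intro a ha b hb
    rw [← h1 a ha, ← h1 b hb]
  refine ⟨⟨(⋃₀ {T ∈ S | x ∉ T})ᶜ, ?_⟩, ?_, fun y hy hyx ↦ ?_⟩
  · rw [isOpen_compl_iff, Set.sUnion_eq_biUnion]
    exact (hS.subset (Set.sep_subset _ _)).isClosed_biUnion fun T hT ↦ hSc T hT.1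
  · rintro ⟨T, hT, hxT⟩
    exact hT.2 hxT
  · by_contra hyW
    have : y ∈ ⋃₀ S := hSU ▸ (show y ∈ (W : Set C.X)ᶜ from hyW)
    obtain ⟨T, hT, hyT⟩ := this
    exact hy ⟨T, ⟨hT, fun hxT ↦ hyx (hsub T hT hyT hxT)⟩, hyT⟩

/-- A rational function is regular at all points of some punctured neighbourhood. -/
theorem exists_nhd_regularFunctions (x : C.X) (g : C.K) :
    ∃ V : C.X.Opens, x ∈ V ∧ ∀ y ∈ V, y ≠ x → y ∈ C.U ∧ g ∈ C.regularFunctions y := by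
  obtain ⟨W, hW, s, rfl⟩ := C.X.presheaf.exists_germ_eq g
  have : Nonempty W := ⟨⟨_, hW⟩⟩
  obtain ⟨V, hxV, hV⟩ := C.exists_punctured_nhd_le W x
  obtain ⟨V', hxV', hV'⟩ := C.exists_punctured_nhd_le C.U x
  exact ⟨V ⊓ V', ⟨hxV, hxV'⟩, fun y hy hyx ↦ ⟨hV' y hy.2 hyx,
    C.X.presheaf.germ W y (hV y hy.1 hyx) s,
    C.X.presheaf.germ_stalkSpecializes_apply (U := W) (hV y hy.1 hyx)
      ((genericPoint_spec C.X).specializes trivial) s⟩⟩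

/-! ### Inclusions of subcomplexes that are quasi-isomorphisms -/

variable {C}

/-- The stalkwise criterion for the inclusion of one subcomplex in another to be a
quasi-isomorphism: `∇` has to induce a bijection between the quotients of the functions and of the
forms. As sections are germs that are allowed on an open set, a function allowed at a point
of `X ∖ U` has to be allowed in a neighbourhood. -/
theorem quasiIso_incl {A B : C.Subcomplex} (h : A ≤ B)
    (hU : ∀ x ∈ C.U, B.form x ≤ A.form x)
    (hinj : ∀ x, ∀ g ∈ B.fn x, C.nabla g ∈ A.form x → g ∈ A.fn x)
    (hsurj : ∀ x ∉ C.U, ∀ w ∈ B.form x, ∃ g ∈ B.fn x, w - C.nabla g ∈ A.form x)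
    (hspread : ∀ x ∉ C.U, ∀ g ∈ B.fn x, ∃ W : C.X.Opens, x ∈ W ∧ ∀ y ∈ W, g ∈ B.fn y) :
    QuasiIso (Subcomplex.incl h) := by
  -- the pairs of a function of `B` and a form of `A`; they have to cover the forms of `B`
  let AB (x : C.X.carrier) : Submodule ℂ (C.K × Ω[C.K⁄ℂ]) := (B.fn x).prod (A.form x)
  refine quasiIso_double _ _ (sheafMap LinearMap.id h.1) (sheafMap LinearMap.id h.2) _
    (Subcomplex.incl h) (HomologicalComplex.mkHomFromDouble_f₀ ..)
    (HomologicalComplex.mkHomFromDouble_f₁ ..) ?_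
    (Z := sheafOf AB)
    (sheafMap (LinearMap.fst ℂ _ _) (fun x m hm ↦ hm.1))
    (sheafMap (LinearMap.snd ℂ _ _) (fun x m hm ↦ hm.2)) ?_
  · intro T y z hyz
    refine exists_lift_sheafMap_id h.1 y fun V t x ↦ hinj _ _ ((onSections y V t).2.2 x) ?_
    have h1 := congrFun (congrArg (fun g ↦ (onSections g V t).1) hyz) x
    exact Set.mem_of_eq_of_mem h1 ((onSections z V t).2.2 x)
  · change Epi (sheafMap (A := AB) (B := B.form)
        (C.nabla ∘ₗ LinearMap.fst ℂ _ _ + LinearMap.snd ℂ _ _)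
        (fun x m hm ↦ add_mem (B.nabla_mem x _ hm.1) (h.2 x hm.2)))
    refine epi_sheafMap _ _ fun V w hw x hx ↦ ?_
    by_cases hxU : x ∈ C.U
    · exact ⟨(0, w), by simp, C.U, hxU, fun y hy hyV ↦ ⟨zero_mem _, hU y hy (hw y hyV)⟩⟩
    · obtain ⟨g, hg, hgw⟩ := hsurj x hxU w (hw x hx)
      obtain ⟨W, hxW, hW⟩ := hspread x hxU g hg
      obtain ⟨W', hxW', hW'⟩ := C.exists_punctured_nhd_le C.U x
      refine ⟨(g, w - C.nabla g), by simp, W ⊓ W', ⟨hxW, hxW'⟩, fun y hy hyV ↦ ⟨hW y hy.1, ?_⟩⟩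
      by_cases hyx : y = x
      · rwa [hyx]
      · exact hU y (hW' y hy.2 hyx) (sub_mem (hw y hyV) (B.nabla_mem y g (hW y hy.1)))

end CompletedCurve

/-! ### Differentials on a smooth local ring of dimension one -/

section LocalRing
variable {R : Type} [CommRing R] [IsDomain R] [IsLocalRing R] [Algebra ℂ R]
  [Algebra.EssFiniteType ℂ R] [Algebra.FormallySmooth ℂ R]

/-- By formal smoothness `𝔪 / 𝔪²` embeds into `κ ⊗ Ω`, so the class of `t` does not vanish in the
line `κ ⊗ Ω`. -/
theorem exists_unit_D_uniformizer {t : R} (ht : Ideal.span {t} = maximalIdeal R) (ht0 : t ≠ 0)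
    (b : Module.Basis (Fin 1) R Ω[R⁄ℂ]) :
    ∃ c : Rˣ, KaehlerDifferential.D ℂ R t = c • b 0 := by
  have : Algebra.EssFiniteType R (ResidueField R) := inferInstance
  have : Algebra.EssFiniteType ℂ (ResidueField R) := Algebra.EssFiniteType.comp ℂ R _
  have : Algebra.FormallySmooth ℂ (ResidueField R) := inferInstance
  have hinj := (Algebra.FormallySmooth.kerCotangentToTensor_injective_iff (R := ℂ)
    (residue_surjective : Function.Surjective (algebraMap R (ResidueField R)))).2 inferInstance
  have hker : RingHom.ker (algebraMap R (ResidueField R)) = maximalIdeal R := ker_residue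
  have htm : t ∈ RingHom.ker (algebraMap R (ResidueField R)) := by
    rw [hker, ← ht]
    exact Ideal.mem_span_singleton_self t
  have hb : KaehlerDifferential.D ℂ R t = b.repr (KaehlerDifferential.D ℂ R t) 0 • b 0 := by
    conv_lhs => rw [← b.sum_repr (KaehlerDifferential.D ℂ R t)]
    simp
  suffices IsUnit (b.repr (KaehlerDifferential.D ℂ R t) 0) by
    obtain ⟨c, hc⟩ := this
    exact ⟨c, by rw [hb, ← hc]; rfl⟩
  by_contra hc
  have hc0 : residue R (b.repr (KaehlerDifferential.D ℂ R t) 0) = 0 :=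
    (residue_eq_zero_iff _).2 ((mem_maximalIdeal _).2 hc)
  have h1 : (RingHom.ker (algebraMap R (ResidueField R))).toCotangent ⟨t, htm⟩ = 0 := by
    apply hinj
    rw [KaehlerDifferential.kerCotangentToTensor_toCotangent, map_zero]
    change TensorProduct.tmul R (1 : ResidueField R) (KaehlerDifferential.D ℂ R t) = 0
    rw [hb, TensorProduct.tmul_smul, TensorProduct.smul_tmul', Algebra.smul_def, mul_one]
    rw [show algebraMap R (ResidueField R) _ = 0 from hc0, TensorProduct.zero_tmul]
  rw [Ideal.toCotangent_eq_zero] at h1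
  change t ∈ _ at h1
  rw [hker, ← ht, Ideal.span_singleton_pow,
    Ideal.mem_span_singleton] at h1
  obtain ⟨d, hd⟩ := h1
  have hu : IsUnit t := by
    refine IsUnit.of_mul_eq_one d (mul_left_cancel₀ ht0 ?_)
    rw [mul_one]
    conv_rhs => rw [hd]
    ring
  have : t ∈ maximalIdeal R := ht ▸ Ideal.mem_span_singleton_self t
  exact (mem_maximalIdeal t).1 this hu

/-- The differential `dt` of a uniformizer generates `Ω`. -/
theorem exists_smul_D_uniformizer {t : R} (ht : Ideal.span {t} = maximalIdeal R) (ht0 : t ≠ 0)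
    (b : Module.Basis (Fin 1) R Ω[R⁄ℂ]) (z : Ω[R⁄ℂ]) :
    ∃ a : R, z = a • KaehlerDifferential.D ℂ R t := by
  obtain ⟨c, hc⟩ := exists_unit_D_uniformizer ht ht0 b
  refine ⟨b.repr z 0 * (c⁻¹ : Rˣ), ?_⟩
  rw [hc, Units.smul_def, smul_smul, mul_assoc, Units.inv_mul, mul_one]
  conv_lhs => rw [← b.sum_repr z]
  simp

/-- As `Ω` is free over `R`, it embeds into `Ω_K`, so the generator `dt` survives in `Ω_K`. -/
theorem D_uniformizer_ne_zero {t : R} (ht : Ideal.span {t} = maximalIdeal R) (ht0 : t ≠ 0)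
    (b : Module.Basis (Fin 1) R Ω[R⁄ℂ])
    (K : Type) [Field K] [Algebra R K] [IsFractionRing R K] [Algebra ℂ K] [IsScalarTower ℂ R K] :
    KaehlerDifferential.D ℂ K (algebraMap R K t) ≠ 0 := by
  obtain ⟨c, hc⟩ := exists_unit_D_uniformizer ht ht0 b
  have := KaehlerDifferential.isLocalizedModule_map ℂ R K (nonZeroDivisors R)
  rw [← KaehlerDifferential.map_D ℂ ℂ R K t]
  intro h
  obtain ⟨m, hm⟩ := (IsLocalizedModule.eq_zero_iff (nonZeroDivisors R)
    (KaehlerDifferential.map ℂ ℂ R K)).1 h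
  have h2 := congrArg (fun z ↦ b.repr z 0) hm
  rw [hc] at h2
  simp [Submonoid.smul_def, Units.smul_def] at h2

end LocalRing

namespace CompletedCurve
variable (C : CompletedCurve)

/-- The local rings inherit smoothness of relative dimension one: a standard smooth affine
neighbourhood over `ℂ` has free differentials of rank one, and localizing keeps this. -/
theorem stalk_smooth (x : C.X) :
    Algebra.EssFiniteType ℂ (C.X.presheaf.stalk x) ∧
      Algebra.FormallySmooth ℂ (C.X.presheaf.stalk x) ∧
      Nonempty (Module.Basis (Fin 1) (C.X.presheaf.stalk x) Ω[C.X.presheaf.stalk x⁄ℂ]) := by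
  obtain ⟨W, hW, V, hV, hx, e, hs⟩ :=
    SmoothOfRelativeDimension.exists_isStandardSmoothOfRelativeDimension (n := 1) (f := C.str) x
  -- `Spec ℂ` is a point, so the chart of the base is everything
  have hWtop : W = ⊤ := by
    have hsub : Subsingleton (Spec (CommRingCat.of ℂ)) :=
      inferInstanceAs (Subsingleton (PrimeSpectrum ℂ))
    refine eq_top_iff.2 fun y _ ↦ ?_
    rw [Subsingleton.elim y (C.str x)]
    exact e hx
  subst hWtop
  let _ : Algebra ℂ Γ(C.X, V) :=
    ((C.str.appLE ⊤ V e).hom.comp (Scheme.ΓSpecIso (CommRingCat.of ℂ)).inv.hom).toAlgebra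
  have hstd : Algebra.IsStandardSmoothOfRelativeDimension 1 ℂ Γ(C.X, V) :=
    hs.comp (RingHom.IsStandardSmoothOfRelativeDimension.equiv
      (Scheme.ΓSpecIso (CommRingCat.of ℂ)).commRingCatIsoToRingEquiv.symm)
  let _ : Algebra Γ(C.X, V) (C.X.presheaf.stalk x) := (C.X.presheaf.germ V x hx).hom.toAlgebra
  have : IsScalarTower ℂ Γ(C.X, V) (C.X.presheaf.stalk x) :=
    IsScalarTower.of_algebraMap_eq' (algebraMap_stalk C V x hx e).symm
  have hloc : IsLocalization.AtPrime (C.X.presheaf.stalk x) (hV.primeIdealOf ⟨x, hx⟩).asIdeal :=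
    hV.isLocalization_stalk ⟨x, hx⟩
  have : Nontrivial Γ(C.X, V) := (C.X.presheaf.germ V x hx).hom.domain_nontrivial
  have : Algebra.IsStandardSmooth ℂ Γ(C.X, V) := hstd.isStandardSmooth
  have : Algebra.EssFiniteType Γ(C.X, V) (C.X.presheaf.stalk x) :=
    Algebra.EssFiniteType.of_isLocalization _ (hV.primeIdealOf ⟨x, hx⟩).asIdeal.primeCompl
  have : Algebra.FormallySmooth Γ(C.X, V) (C.X.presheaf.stalk x) :=
    Algebra.FormallySmooth.of_isLocalization (hV.primeIdealOf ⟨x, hx⟩).asIdeal.primeCompl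
  have hrank := Algebra.IsStandardSmoothOfRelativeDimension.rank_kaehlerDifferential
    (R := ℂ) (S := Γ(C.X, V)) 1
  have : Module.Free Γ(C.X, V) Ω[Γ(C.X, V)⁄ℂ] := inferInstance
  obtain ⟨b⟩ : Nonempty (Module.Basis (Fin 1) Γ(C.X, V) Ω[Γ(C.X, V)⁄ℂ]) := by
    have h1 : Module.finrank Γ(C.X, V) Ω[Γ(C.X, V)⁄ℂ] = 1 := by
      simp [Module.finrank, hrank]
    exact ⟨Module.basisUnique (Fin 1) h1⟩
  have := KaehlerDifferential.isLocalizedModule_map ℂ Γ(C.X, V) (C.X.presheaf.stalk x)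
    (hV.primeIdealOf ⟨x, hx⟩).asIdeal.primeCompl
  exact ⟨Algebra.EssFiniteType.comp ℂ Γ(C.X, V) _, .comp ℂ Γ(C.X, V) _,
    ⟨b.ofIsLocalizedModule (C.X.presheaf.stalk x) (hV.primeIdealOf ⟨x, hx⟩).asIdeal.primeCompl
      (KaehlerDifferential.map ℂ ℂ Γ(C.X, V) (C.X.presheaf.stalk x))⟩⟩

/-! ### Functions and forms with prescribed poles in terms of a uniformizer -/

section Uniformizer
variable {C} {x : C.X} {t : C.X.presheaf.stalk x}

/-- At the generic point the maximal ideal is zero and there is no condition on the poles. -/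
theorem functionsWithPole_eq_top (ht : Ideal.span {t} = maximalIdeal (C.X.presheaf.stalk x))
    (h : t = 0) (n : ℤ) : C.functionsWithPole x n = ⊤ := by
  rw [h, Ideal.span_singleton_eq_bot.2 rfl] at ht
  refine eq_top_iff.2 fun g _ u _ ↦ ?_
  rw [C.regularFunctions_eq_top ht.symm]
  trivial

theorem formsWithPole_eq_top (ht : Ideal.span {t} = maximalIdeal (C.X.presheaf.stalk x))
    (h : t = 0) (n : ℤ) : C.formsWithPole x n = ⊤ := by
  rw [h, Ideal.span_singleton_eq_bot.2 rfl] at ht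
  refine eq_top_iff.2 fun g _ u _ ↦ ?_
  rw [C.regularForms_eq_top ht.symm]
  trivial

theorem algebraMap_uniformizer_ne_zero (h : t ≠ 0) :
    algebraMap (C.X.presheaf.stalk x) C.K t ≠ 0 :=
  (map_ne_zero_iff _ (IsFractionRing.injective _ _)).2 h

/-- Two uniformizers have the same powers up to regular functions. -/
theorem zpow_uniformizer_div_mem {u : C.X.presheaf.stalk x}
    (ht : Ideal.span {t} = maximalIdeal (C.X.presheaf.stalk x))
    (hu : Ideal.span {u} = maximalIdeal (C.X.presheaf.stalk x)) (n : ℤ) :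
    ∃ a ∈ C.regularFunctions x, algebraMap (C.X.presheaf.stalk x) C.K u ^ n =
      a * algebraMap (C.X.presheaf.stalk x) C.K t ^ n := by
  obtain ⟨c, rfl⟩ := Ideal.span_singleton_eq_span_singleton.1 (ht.trans hu.symm)
  refine ⟨algebraMap (C.X.presheaf.stalk x) C.K c ^ n,
    ⟨((c ^ n : (C.X.presheaf.stalk x)ˣ) : C.X.presheaf.stalk x), ?_⟩, ?_⟩
  · have := congrArg Units.val (map_zpow (Units.map
      (algebraMap (C.X.presheaf.stalk x) C.K).toMonoidHom) c n)
    rw [Units.val_zpow_eq_zpow_val] at this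
    exact this
  · rw [map_mul, mul_zpow, mul_comm]

/-- The condition that defines `functionsWithPole` need only be tested on one uniformizer. -/
theorem mem_functionsWithPole_iff (ht : Ideal.span {t} = maximalIdeal (C.X.presheaf.stalk x))
    {n : ℤ} {g : C.K} : g ∈ C.functionsWithPole x n ↔
      algebraMap (C.X.presheaf.stalk x) C.K t ^ n * g ∈ C.regularFunctions x := by
  refine ⟨fun h ↦ h t ht, fun h u hu ↦ ?_⟩
  obtain ⟨a, ha, hau⟩ := zpow_uniformizer_div_mem ht hu n
  rw [hau, mul_assoc]
  exact C.mul_mem_regularFunctions ha h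

theorem mem_formsWithPole_iff (ht : Ideal.span {t} = maximalIdeal (C.X.presheaf.stalk x))
    {n : ℤ} {w : Ω[C.K⁄ℂ]} : w ∈ C.formsWithPole x n ↔
      algebraMap (C.X.presheaf.stalk x) C.K t ^ n • w ∈ C.regularForms x := by
  refine ⟨fun h ↦ h t ht, fun h u hu ↦ ?_⟩
  obtain ⟨a, ha, hau⟩ := zpow_uniformizer_div_mem ht hu n
  rw [hau, mul_smul]
  exact C.smul_mem_regularForms ha h

theorem mem_functionsWithPole_iff_exists
    (ht : Ideal.span {t} = maximalIdeal (C.X.presheaf.stalk x)) (ht0 : t ≠ 0) {n : ℤ} {g : C.K} :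
    g ∈ C.functionsWithPole x n ↔ ∃ a : C.X.presheaf.stalk x,
      g = algebraMap (C.X.presheaf.stalk x) C.K t ^ (-n) * algebraMap _ C.K a := by
  have h0 := algebraMap_uniformizer_ne_zero ht0
  rw [mem_functionsWithPole_iff ht]
  refine exists_congr fun a ↦ ?_
  change algebraMap _ C.K a = _ ↔ _
  rw [zpow_neg, eq_inv_mul_iff_mul_eq₀ (zpow_ne_zero _ h0), eq_comm]

theorem mem_formsWithPole_iff_exists
    (ht : Ideal.span {t} = maximalIdeal (C.X.presheaf.stalk x)) (ht0 : t ≠ 0)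
    {n : ℤ} {w : Ω[C.K⁄ℂ]} :
    w ∈ C.formsWithPole x n ↔ ∃ a : C.X.presheaf.stalk x,
      w = (algebraMap (C.X.presheaf.stalk x) C.K t ^ (-n) * algebraMap _ C.K a) •
        KaehlerDifferential.D ℂ C.K (algebraMap _ C.K t) := by
  have h0 := algebraMap_uniformizer_ne_zero ht0
  obtain ⟨_, _, ⟨b⟩⟩ := C.stalk_smooth x
  have hmap (a : C.X.presheaf.stalk x) : KaehlerDifferential.map ℂ ℂ (C.X.presheaf.stalk x) C.K
      (a • KaehlerDifferential.D ℂ _ t) =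
      algebraMap _ C.K a • KaehlerDifferential.D ℂ C.K (algebraMap _ C.K t) := by
    rw [map_smul, KaehlerDifferential.map_D, algebraMap_smul]
  rw [mem_formsWithPole_iff ht]
  -- `Ω¹` is generated by `dt` at `x`, so regular forms are the regular multiples of `dt`
  have hiff (a : C.X.presheaf.stalk x) : algebraMap (C.X.presheaf.stalk x) C.K t ^ n • w =
      algebraMap _ C.K a • KaehlerDifferential.D ℂ C.K (algebraMap _ C.K t) ↔
      w = (algebraMap (C.X.presheaf.stalk x) C.K t ^ (-n) * algebraMap _ C.K a) •
        KaehlerDifferential.D ℂ C.K (algebraMap _ C.K t) := by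
    rw [mul_smul, zpow_neg, eq_inv_smul_iff₀ (zpow_ne_zero _ h0)]
  constructor
  · rintro ⟨z, hz⟩
    obtain ⟨a, rfl⟩ := exists_smul_D_uniformizer ht ht0 b z
    exact ⟨a, (hiff a).1 (hz.symm.trans (hmap a))⟩
  · rintro ⟨a, ha⟩
    exact ⟨a • KaehlerDifferential.D ℂ _ t, (hmap a).trans ((hiff a).2 ha).symm⟩

theorem functionsWithPole_mono (x : C.X) {m n : ℤ} (h : m ≤ n) :
    C.functionsWithPole x m ≤ C.functionsWithPole x n := by
  intro g hg t ht
  rcases C.algebraMap_ne_zero_or ht with h0 | h0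
  · obtain ⟨k, rfl⟩ := Int.le.dest h
    rw [add_comm, zpow_add₀ h0, mul_assoc, zpow_natCast, ← map_pow]
    exact C.mul_mem_regularFunctions ⟨t ^ k, rfl⟩ (hg t ht)
  · rw [h0.1]
    trivial

/-! ### The leading term of the connection -/

/-- If `P > 0` at `x`, the function `f` is a unit times `t ^ (-P)`. -/
theorem exists_unit_fK (ht : Ideal.span {t} = maximalIdeal (C.X.presheaf.stalk x)) (ht0 : t ≠ 0)
    (hP : C.P x ≠ 0) : ∃ c : (C.X.presheaf.stalk x)ˣ, C.fK =
      algebraMap (C.X.presheaf.stalk x) C.K t ^ (-(C.P x : ℤ)) *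
        algebraMap _ C.K (c : C.X.presheaf.stalk x) := by
  have h0 := algebraMap_uniformizer_ne_zero ht0
  obtain ⟨a, ha⟩ := (mem_functionsWithPole_iff_exists ht ht0).1 (C.fK_mem x)
  -- otherwise one power of `t` splits off, which contradicts the minimality of the pole order
  by_contra! hc
  have ham : a ∈ maximalIdeal (C.X.presheaf.stalk x) := by
    rw [mem_maximalIdeal]
    rintro ⟨c, rfl⟩
    exact hc c ha
  rw [← ht] at ham
  obtain ⟨d, rfl⟩ := Ideal.mem_span_singleton.1 ham
  have hmem : C.fK ∈ C.functionsWithPole x ((C.P x - 1 : ℕ) : ℤ) := by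
    refine (mem_functionsWithPole_iff_exists ht ht0).2 ⟨d, ?_⟩
    rw [ha, map_mul, ← mul_assoc, ← zpow_add_one₀ h0]
    congr 2
    push_cast [Nat.one_le_iff_ne_zero.2 hP]
    ring
  have := Nat.sInf_le (s := {n : ℕ | C.fK ∈ C.functionsWithPole x n}) hmem
  change C.P x ≤ _ at this
  omega

theorem isUnit_intCast_stalk (x : C.X) {n : ℤ} (hn : n ≠ 0) :
    IsUnit ((n : ℤ) : C.X.presheaf.stalk x) := by
  have := (IsUnit.mk0 (n : ℂ) (Int.cast_ne_zero.2 hn)).map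
    (algebraMap ℂ (C.X.presheaf.stalk x))
  rwa [map_intCast] at this

/-- On functions with a pole of order `n`, the connection is, up to lower order terms,
multiplication by `t ^ (-P - 1)`, a unit and `dt`. If `P > 0` the unit comes from `df`; if `P = 0`
it is `-n`, and `n ≠ 0` is needed. -/
theorem exists_leading_term (ht : Ideal.span {t} = maximalIdeal (C.X.presheaf.stalk x))
    (ht0 : t ≠ 0) {n : ℤ} (hn : C.P x = 0 → n ≠ 0) :
    ∃ e : (C.X.presheaf.stalk x)ˣ, ∀ a : C.X.presheaf.stalk x,
      C.nabla (algebraMap (C.X.presheaf.stalk x) C.K t ^ (-n) * algebraMap _ C.K a) -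
        (algebraMap (C.X.presheaf.stalk x) C.K t ^ (-(n + C.P x + 1)) *
          algebraMap _ C.K (e * a)) • KaehlerDifferential.D ℂ C.K (algebraMap _ C.K t) ∈
        C.formsWithPole x (n + C.P x) := by
  have h0 := algebraMap_uniformizer_ne_zero ht0
  have hpow (m : ℤ) (a : C.X.presheaf.stalk x) :
      algebraMap (C.X.presheaf.stalk x) C.K t ^ (-m) * algebraMap _ C.K a ∈
        C.functionsWithPole x m := (mem_functionsWithPole_iff_exists ht ht0).2 ⟨a, rfl⟩
  have hpow' (m : ℤ) :
      algebraMap (C.X.presheaf.stalk x) C.K t ^ (-m) ∈ C.functionsWithPole x m := by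
    simpa using hpow m 1
  have hD (a : C.X.presheaf.stalk x) :
      KaehlerDifferential.D ℂ C.K (algebraMap _ C.K a) ∈ C.formsWithPole x 0 := by
    rw [formsWithPole_zero]
    exact C.D_mem_regularForms ⟨a, rfl⟩
  -- the two terms of `d (t ^ (-m) * a)`; only the second one raises the pole order
  have hleib (m : ℤ) (a : C.X.presheaf.stalk x) : KaehlerDifferential.D ℂ C.K
      (algebraMap (C.X.presheaf.stalk x) C.K t ^ (-m) * algebraMap _ C.K a) =
      algebraMap (C.X.presheaf.stalk x) C.K t ^ (-m) •
        KaehlerDifferential.D ℂ C.K (algebraMap _ C.K a) +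
      (algebraMap (C.X.presheaf.stalk x) C.K t ^ (-(m + 1)) * algebraMap _ C.K (-(m : ℤ) * a)) •
        KaehlerDifferential.D ℂ C.K (algebraMap _ C.K t) := by
    rw [Derivation.leibniz, Derivation.leibniz_zpow,
      ← Int.cast_smul_eq_zsmul C.K, smul_smul, smul_smul]
    congr 2
    rw [map_mul, map_neg, map_intCast, neg_add, ← sub_eq_add_neg]
    push_cast
    ring
  by_cases hP : C.P x = 0
  · obtain ⟨e, he⟩ := (isUnit_intCast_stalk x (hn hP)).neg
    refine ⟨e, fun a ↦ ?_⟩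
    have hf := C.fK_mem x
    rw [hP, Nat.cast_zero, functionsWithPole_zero] at hf
    have hDf : KaehlerDifferential.D ℂ C.K C.fK ∈ C.formsWithPole x 0 := by
      rw [formsWithPole_zero]
      exact C.D_mem_regularForms hf
    rw [nabla_apply, hleib, hP, Nat.cast_zero, add_zero, he, add_right_comm, add_sub_cancel_right,
      ← add_zero n]
    exact add_mem (C.smul_mem_formsWithPole (by simpa using hpow' n) (hD a))
      (C.smul_mem_formsWithPole (by simpa using hpow n a) hDf)
  · obtain ⟨c, hc⟩ := exists_unit_fK ht ht0 hP
    obtain ⟨e, he⟩ := (isUnit_intCast_stalk x (n := C.P x) (by exact_mod_cast hP)).neg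
    refine ⟨e * c, fun a ↦ ?_⟩
    -- the lower order terms: `dg`, and the part of `g df` that comes from `dc`, where
    -- `f = t ^ (-P) * c`
    have h1 : KaehlerDifferential.D ℂ C.K
        (algebraMap (C.X.presheaf.stalk x) C.K t ^ (-n) * algebraMap _ C.K a) ∈
        C.formsWithPole x (n + C.P x) :=
      C.formsWithPole_mono x (by omega) (C.D_mem_formsWithPole (hpow n a))
    have h2 := C.smul_mem_formsWithPole (hpow n a)
      (C.smul_mem_formsWithPole (hpow' (C.P x)) (hD c))
    rw [add_zero] at h2
    convert add_mem h1 h2 using 1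
    rw [nabla_apply, add_sub_assoc]
    congr 1
    conv_lhs => rw [hc, hleib, smul_add, add_sub_assoc]
    rw [add_eq_left, smul_smul, ← sub_smul]
    convert zero_smul C.K _ using 2
    rw [Units.val_mul, he, neg_add, neg_add, neg_add, zpow_add₀ h0, zpow_add₀ h0, zpow_add₀ h0]
    simp only [map_mul]
    ring

/-- On the graded pieces of the filtration by pole order, `∇` is injective. -/
theorem mem_functionsWithPole_sub_one {n : ℤ} (hn : C.P x = 0 → n ≠ 0) {g : C.K}
    (hg : g ∈ C.functionsWithPole x n) (hng : C.nabla g ∈ C.formsWithPole x (n + C.P x)) :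
    g ∈ C.functionsWithPole x (n - 1) := by
  obtain ⟨t, ht⟩ := C.exists_uniformizer x
  by_cases ht0 : t = 0
  · rw [functionsWithPole_eq_top ht ht0]
    trivial
  have h0 := algebraMap_uniformizer_ne_zero ht0
  obtain ⟨_, _, ⟨b⟩⟩ := C.stalk_smooth x
  have hθ := D_uniformizer_ne_zero ht ht0 b C.K
  obtain ⟨a, rfl⟩ := (mem_functionsWithPole_iff_exists ht ht0).1 hg
  obtain ⟨e, he⟩ := exists_leading_term ht ht0 hn
  have h1 := sub_mem hng (he a)
  rw [sub_sub_cancel] at h1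
  obtain ⟨r, hr⟩ := (mem_formsWithPole_iff_exists ht ht0).1 h1
  have h2 := smul_left_injective C.K hθ hr
  have h3 : (e : C.X.presheaf.stalk x) * a = t * r := by
    apply IsFractionRing.injective (C.X.presheaf.stalk x) C.K
    rw [map_mul (algebraMap _ C.K) t]
    rw [show -(n + (C.P x : ℤ)) = -(n + C.P x + 1) + 1 by ring, zpow_add_one₀ h0, mul_assoc] at h2
    exact mul_left_cancel₀ (zpow_ne_zero _ h0) h2
  refine (mem_functionsWithPole_iff_exists ht ht0).2 ⟨(e⁻¹ : (C.X.presheaf.stalk x)ˣ) * r, ?_⟩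
  have h4 : a = t * ((e⁻¹ : (C.X.presheaf.stalk x)ˣ) * r) := by
    rw [mul_left_comm, ← h3, ← mul_assoc, Units.inv_mul, one_mul]
  rw [h4, map_mul, ← mul_assoc, ← zpow_add_one₀ h0]
  congr 2
  ring

/-- On the graded pieces of the filtration by pole order, `∇` is surjective. -/
theorem exists_sub_nabla_mem_formsWithPole {n : ℤ} (hn : C.P x = 0 → n ≠ 0) {w : Ω[C.K⁄ℂ]}
    (hw : w ∈ C.formsWithPole x (n + C.P x + 1)) :
    ∃ g ∈ C.functionsWithPole x n, w - C.nabla g ∈ C.formsWithPole x (n + C.P x) := by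
  obtain ⟨t, ht⟩ := C.exists_uniformizer x
  by_cases ht0 : t = 0
  · rw [formsWithPole_eq_top ht ht0]
    exact ⟨0, zero_mem _, trivial⟩
  obtain ⟨r, rfl⟩ := (mem_formsWithPole_iff_exists ht ht0).1 hw
  obtain ⟨e, he⟩ := exists_leading_term ht ht0 hn
  refine ⟨_, (mem_functionsWithPole_iff_exists ht ht0).2
    ⟨(e⁻¹ : (C.X.presheaf.stalk x)ˣ) * r, rfl⟩, ?_⟩
  have h1 := neg_mem (he ((e⁻¹ : (C.X.presheaf.stalk x)ˣ) * r))
  rwa [neg_sub, Units.mul_inv_cancel_left] at h1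

end Uniformizer

theorem P_and_Pred_cases (x : C.X) : C.P x = 0 ∧ C.Pred x = 0 ∨ C.P x ≠ 0 ∧ C.Pred x = 1 := by
  unfold Pred
  split_ifs with h <;> simp [h]

/-- The connection is injective from the functions modulo `𝒪(-P_red)` to the forms modulo
`Ω¹(log S)(P - P_red)`, whatever poles are allowed. -/
theorem mem_functionsWithPole_neg_Pred (x : C.X) (g : C.K)
    (hg : C.nabla g ∈ C.formsWithPole x (1 + C.P x - C.Pred x)) :
    g ∈ C.functionsWithPole x (-C.Pred x) := by
  -- lower the pole order of `g` step by step
  have key : ∀ k : ℕ, g ∈ C.functionsWithPole x (-C.Pred x + k) →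
      g ∈ C.functionsWithPole x (-C.Pred x) := by
    intro k
    induction k with
    | zero => simp
    | succ k ih =>
      intro h
      refine ih ?_
      have hP := C.P_and_Pred_cases x
      have := mem_functionsWithPole_sub_one (by omega) h
        (C.formsWithPole_mono x (by push_cast; omega) hg)
      convert this using 2
      push_cast
      ring
  obtain ⟨n, hn⟩ := C.exists_pole x g
  have hP := C.P_and_Pred_cases x
  exact key (n + 1) (functionsWithPole_mono x (by push_cast; omega) hn)

/-- The connection is surjective from the functions to the forms modulo
`Ω¹(log S)(P - P_red)`, compatibly with bounds on the poles. -/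
theorem exists_sub_nabla_mem_log (x : C.X) {n : ℤ} (hn : -C.Pred x ≤ n) {w : Ω[C.K⁄ℂ]}
    (hw : w ∈ C.formsWithPole x (n + C.P x + 1)) :
    ∃ g ∈ C.functionsWithPole x n, w - C.nabla g ∈ C.formsWithPole x (1 + C.P x - C.Pred x) := by
  obtain ⟨k, rfl⟩ := Int.le.dest hn
  clear hn
  induction k generalizing w with
  | zero =>
    refine ⟨0, zero_mem _, ?_⟩
    rw [map_zero, sub_zero]
    convert hw using 2
    push_cast
    ring
  | succ k ih =>
    have hP := C.P_and_Pred_cases x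
    obtain ⟨g, hg, hgw⟩ := exists_sub_nabla_mem_formsWithPole (by omega) hw
    obtain ⟨g', hg', hgw'⟩ := ih (w := w - C.nabla g) (by
      convert hgw using 2
      push_cast
      ring)
    refine ⟨g + g', add_mem hg (functionsWithPole_mono x (by push_cast; omega) hg'), ?_⟩
    rwa [map_add, ← sub_sub]

theorem exists_pole_form (x : C.X) (w : Ω[C.K⁄ℂ]) : ∃ n : ℕ, w ∈ C.formsWithPole x n := by
  have hw : w ∈ Submodule.span C.K (Set.range (KaehlerDifferential.D ℂ C.K)) := by
    rw [KaehlerDifferential.span_range_derivation]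
    trivial
  induction hw using Submodule.span_induction with
  | mem w hw =>
    obtain ⟨g, rfl⟩ := hw
    obtain ⟨n, hn⟩ := C.exists_pole x g
    exact ⟨n + 1, by exact_mod_cast C.D_mem_formsWithPole hn⟩
  | zero => exact ⟨0, zero_mem _⟩
  | add w z _ _ h1 h2 =>
    obtain ⟨m, hm⟩ := h1
    obtain ⟨n, hn⟩ := h2
    exact ⟨m + n, add_mem (C.formsWithPole_mono x (by omega) hm)
      (C.formsWithPole_mono x (by omega) hn)⟩
  | smul g w _ h1 =>
    obtain ⟨m, hm⟩ := h1
    obtain ⟨n, hn⟩ := C.exists_pole x g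
    exact ⟨n + m, by exact_mod_cast C.smul_mem_formsWithPole hn hm⟩

variable {C}

/-! ### The steps of the two filtrations -/

theorem logComplex_fn (x : C.X) : C.logComplex.fn x = C.functionsWithPole x (-C.Pred x) := by
  simp [logComplex, ofDivisors, fnDivisor]

theorem logComplex_form (x : C.X) :
    C.logComplex.form x = C.formsWithPole x (C.S x + C.P x - C.Pred x) := by
  simp [logComplex, ofDivisors, formDivisor]

theorem Pred_of_mem {x : C.X} (hx : x ∈ C.U) : C.Pred x = 0 := by
  rw [Pred, if_pos (C.P_eq_zero hx)]

theorem Pred_nonneg (x : C.X) : 0 ≤ C.Pred x := by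
  unfold Pred
  split_ifs <;> norm_num

theorem S_nonneg (x : C.X) : 0 ≤ C.S x := by
  unfold S
  split_ifs <;> norm_num

theorem irrHodge_fn {r : ℝ} (hr : r ≤ 0) (x : C.X) :
    (C.irrHodge r).fn x = C.functionsWithPole x (C.fnDivisor r x) :=
  if_pos (Int.ceil_le.2 (by exact_mod_cast hr))

theorem irrHodge_form {r : ℝ} (hr : r ≤ 1) (x : C.X) :
    (C.irrHodge r).form x = C.formsWithPole x (C.formDivisor r x) :=
  if_pos (Int.ceil_le.2 (by exact_mod_cast hr))

theorem irrHodge_fn_of_pos {r : ℝ} (hr : 0 < r) (x : C.X) : (C.irrHodge r).fn x = ⊥ :=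
  if_neg (fun h ↦ absurd (Int.ceil_le.1 h) (by simpa using hr))

theorem irrHodge_form_of_one_lt {r : ℝ} (hr : 1 < r) (x : C.X) : (C.irrHodge r).form x = ⊥ :=
  if_neg (fun h ↦ absurd (Int.ceil_le.1 h) (by simpa using hr))

theorem deligne_fn {r : ℝ} (hr : r ≤ 0) (x : C.X) :
    (C.deligne r).fn x = C.functionsWithPole x (C.deligneDivisor r x) :=
  if_neg hr.not_gt

theorem deligne_form {r : ℝ} (hr : r ≤ 1) (x : C.X) :
    (C.deligne r).form x = C.formsWithPole x (C.deligneDivisor (r - 1) x) :=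
  if_neg (by linarith)

theorem formDivisor_eq (r : ℝ) (x : C.X) :
    C.formDivisor r x = C.fnDivisor r x + C.P x + C.S x := by
  have h : (1 - r) * (C.P x : ℝ) = -r * C.P x + C.P x := by ring
  rw [formDivisor, fnDivisor, h, Int.floor_add_natCast]
  ring

theorem deligneDivisor_sub_one {r : ℝ} (hr : r ≤ 0) (x : C.X) :
    C.deligneDivisor (r - 1) x = C.deligneDivisor r x + C.P x + C.S x := by
  rw [C.deligneDivisor_of_le (r - 1) (by linarith), sub_add_cancel]
  ring

theorem deligneDivisor_nonneg {r : ℝ} (hr : r ≤ 0) (x : C.X) : 0 ≤ C.deligneDivisor r x := by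
  fun_induction deligneDivisor C r x with
  | case1 r h =>
    have : ⌈r * (C.P x : ℝ)⌉ ≤ 0 :=
      Int.ceil_le.2 (by simpa using mul_nonpos_of_nonpos_of_nonneg hr (Nat.cast_nonneg _))
    have := C.S_nonneg x
    omega
  | case2 r h ih =>
    have := ih (by linarith)
    have := C.S_nonneg x
    omega

theorem fnDivisor_nonneg {r : ℝ} (hr : r ≤ 0) (x : C.X) : 0 ≤ C.fnDivisor r x :=
  Int.floor_nonneg.2 (mul_nonneg (by linarith) (Nat.cast_nonneg _))

/-- In positive degrees of the filtrations only forms remain, and the two filtrations agree. -/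
theorem irrHodge_eq_deligne {r : ℝ} (hr : 0 < r) : C.irrHodge r = C.deligne r := by
  ext1 <;> funext x
  · rw [irrHodge_fn_of_pos hr]
    exact (if_pos hr).symm
  · rcases le_or_gt r 1 with h1 | h1
    · rw [irrHodge_form h1, deligne_form h1, deligneDivisor, if_pos (by linarith), formDivisor,
        sub_eq_add_neg (C.S x), ← Int.floor_neg]
      congr 3
      ring
    · rw [irrHodge_form_of_one_lt h1]
      exact (if_pos (by linarith)).symm

theorem formDivisor_le {r : ℝ} (hr : 0 < r) (x : C.X) :
    C.formDivisor r x ≤ C.S x + C.P x - C.Pred x := by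
  rw [formDivisor_eq]
  suffices C.fnDivisor r x ≤ -C.Pred x by omega
  rcases C.P_and_Pred_cases x with ⟨h1, h2⟩ | ⟨h1, h2⟩
  · simp [fnDivisor, h1, h2]
  · rw [h2, fnDivisor]
    refine Int.le_of_lt_add_one (Int.floor_lt.2 ?_)
    have : (0 : ℝ) < C.P x := by positivity
    simpa using mul_pos hr this

theorem irrHodge_form_le_logComplex {r : ℝ} (hr : 0 < r) (x : C.X) :
    (C.irrHodge r).form x ≤ C.logComplex.form x := by
  rcases le_or_gt r 1 with h1 | h1
  · rw [irrHodge_form h1, logComplex_form]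
    exact C.formsWithPole_mono x (formDivisor_le hr x)
  · rw [irrHodge_form_of_one_lt h1]
    exact bot_le

/-- The forms in `𝔉^{0+}` are those of the logarithmic complex: for small `r > 0`, the floor of
`(1 - r)P` is `P - P_red`. -/
theorem deligneLogComplex_form (x : C.X) : C.deligneLogComplex.form x = C.logComplex.form x := by
  refine le_antisymm (iSup_le fun r ↦ ?_) ?_
  · rw [← irrHodge_eq_deligne r.2]
    exact irrHodge_form_le_logComplex r.2 x
  · have h0 : (0 : ℝ) < C.P x + 1 := by positivity
    have hr : (0 : ℝ) < 1 / (C.P x + 1) := by positivity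
    have h1 : (1 : ℝ) / (C.P x + 1) ≤ 1 := by
      rw [div_le_one h0]
      linarith [(Nat.cast_nonneg (C.P x) : (0 : ℝ) ≤ C.P x)]
    refine le_trans ?_ (le_iSup (fun r : Set.Ioi (0 : ℝ) ↦ (C.deligne r).form x) ⟨_, hr⟩)
    dsimp only
    rw [← irrHodge_eq_deligne hr, irrHodge_form h1, logComplex_form, formDivisor_eq]
    refine C.formsWithPole_mono x ?_
    suffices -C.Pred x ≤ C.fnDivisor (1 / (C.P x + 1)) x by omega
    rcases C.P_and_Pred_cases x with ⟨h2, h3⟩ | ⟨h2, h3⟩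
    · simp [fnDivisor, h2, h3]
    · rw [h3, fnDivisor, Int.le_floor]
      push_cast
      rw [neg_mul, neg_le_neg_iff, one_div_mul_eq_div, div_le_one h0]
      linarith

/-- For functions with at most simple poles on `S`, the condition that `∇ g` lies in `𝔉^{0+}` says
that `g` lies in `𝒪(-P_red)`. -/
theorem deligneLogComplex_fn (x : C.X) : C.deligneLogComplex.fn x = C.logComplex.fn x := by
  change (C.deligne 0).fn x ⊓ (C.deligneLogComplex.form x).comap C.nabla = _
  rw [deligneLogComplex_form, deligne_fn le_rfl]
  refine le_antisymm (fun g hg ↦ ?_) fun g hg ↦ ⟨?_, C.logComplex.nabla_mem x g hg⟩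
  · rw [logComplex_fn]
    by_cases hx : x ∈ C.U
    · have := hg.1
      rwa [C.deligneDivisor_of_mem _ hx, ← neg_zero, ← Pred_of_mem hx] at this
    · have := hg.2
      rw [logComplex_form, C.S_of_notMem hx] at this
      exact C.mem_functionsWithPole_neg_Pred x g this
  · rw [logComplex_fn] at hg
    have := Pred_nonneg x
    have := deligneDivisor_nonneg le_rfl x
    exact functionsWithPole_mono x (by omega) hg

theorem logComplex_eq_deligneLogComplex : C.logComplex = C.deligneLogComplex := by
  ext1 <;> funext x
  · exact (deligneLogComplex_fn x).symm
  · exact (deligneLogComplex_form x).symm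

/-- A step of either filtration of index `≤ 0` contains the logarithmic complex. -/
theorem inf_logComplex_eq {B : C.Subcomplex} (n : C.X → ℤ) (hn : ∀ x, 0 ≤ n x)
    (hfn : ∀ x, B.fn x = C.functionsWithPole x (n x))
    (hform : ∀ x, B.form x = C.formsWithPole x (n x + C.P x + C.S x)) :
    B ⊓ C.logComplex = C.logComplex := by
  ext1 <;> funext x <;> refine inf_eq_right.2 ?_
  · rw [hfn, logComplex_fn]
    have := hn x
    have := Pred_nonneg x
    exact functionsWithPole_mono x (by omega)
  · rw [hform, logComplex_form]
    have := hn x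
    have := Pred_nonneg x
    exact C.formsWithPole_mono x (by omega)

theorem irrHodge_inf_eq_deligne_inf (r : ℝ) :
    C.irrHodge r ⊓ C.logComplex = C.deligne r ⊓ C.deligneLogComplex := by
  rw [← logComplex_eq_deligneLogComplex]
  rcases le_or_gt r 0 with hr | hr
  · rw [inf_logComplex_eq (C.fnDivisor r) (fnDivisor_nonneg hr) (irrHodge_fn hr)
        (fun x ↦ by rw [irrHodge_form (by linarith), formDivisor_eq]),
      inf_logComplex_eq (C.deligneDivisor r) (deligneDivisor_nonneg hr) (deligne_fn hr)
        (fun x ↦ by rw [deligne_form (by linarith), deligneDivisor_sub_one hr])]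
  · rw [irrHodge_eq_deligne hr]

/-! ### The filtered quasi-isomorphisms -/

theorem regularForms_le_logComplex {x : C.X} (hx : x ∈ C.U) :
    C.regularForms x ≤ C.logComplex.form x := by
  rw [logComplex_form, C.S_of_mem hx, C.P_eq_zero hx, Pred_of_mem hx, ← formsWithPole_zero]
  simp

theorem mem_logComplex_fn {B : C.Subcomplex} (hB : ∀ x ∈ C.U, B.fn x ≤ C.regularFunctions x)
    {x : C.X} {g : C.K} (hg : g ∈ B.fn x) (hgw : C.nabla g ∈ C.logComplex.form x) :
    g ∈ C.logComplex.fn x := by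
  rw [logComplex_fn]
  by_cases hx : x ∈ C.U
  · rw [Pred_of_mem hx, neg_zero, functionsWithPole_zero]
    exact hB x hx hg
  · rw [logComplex_form, C.S_of_notMem hx] at hgw
    exact C.mem_functionsWithPole_neg_Pred x g hgw

theorem quasiIso_incl_inf_logComplex {B : C.Subcomplex} (n : C.X → ℤ) (hn : ∀ x, 0 ≤ n x)
    (hn0 : ∀ x ∈ C.U, n x = 0) (hfn : ∀ x, B.fn x = C.functionsWithPole x (n x))
    (hform : ∀ x, B.form x = C.formsWithPole x (n x + C.P x + C.S x)) :
    QuasiIso (Subcomplex.incl (Subcomplex.inf_le_left' B C.logComplex)) := by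
  refine quasiIso_incl _ ?_ ?_ ?_ ?_
  · exact fun x hx ↦ le_inf le_rfl ((B.form_regular x hx).trans (regularForms_le_logComplex hx))
  · exact fun x g hg hgw ↦ ⟨hg, mem_logComplex_fn B.fn_regular hg hgw.2⟩
  · intro x hx w hw
    rw [hform, C.S_of_notMem hx] at hw
    have := hn x
    have := Pred_nonneg x
    obtain ⟨g, hg, hgw⟩ := C.exists_sub_nabla_mem_log x (by omega) hw
    rw [← hfn] at hg
    refine ⟨g, hg, sub_mem ?_ (B.nabla_mem x g hg), ?_⟩
    · rwa [hform, C.S_of_notMem hx]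
    · rwa [SetLike.mem_coe, logComplex_form, C.S_of_notMem hx]
  · intro x _ g hg
    obtain ⟨V, hxV, hV⟩ := C.exists_nhd_regularFunctions x g
    refine ⟨V, hxV, fun y hy ↦ ?_⟩
    by_cases hyx : y = x
    · rwa [hyx]
    · obtain ⟨hyU, hgy⟩ := hV y hy hyx
      rwa [hfn, hn0 y hyU, functionsWithPole_zero]

theorem quasiIso_incl_irrHodge_of_pos {r : ℝ} (hr : 0 < r) :
    QuasiIso (Subcomplex.incl (Subcomplex.inf_le_left' (C.irrHodge r) C.logComplex)) := by
  have h0 (x : C.X) (g : C.K) (hg : g ∈ (C.irrHodge r).fn x) : g = 0 := by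
    rwa [irrHodge_fn_of_pos hr, Submodule.mem_bot] at hg
  refine quasiIso_incl _ (fun x _ ↦ le_inf le_rfl (irrHodge_form_le_logComplex hr x)) ?_ ?_ ?_
  · intro x g hg _
    rw [h0 x g hg]
    exact zero_mem _
  · exact fun x _ w hw ↦ ⟨0, zero_mem _, by
      rw [map_zero, sub_zero]
      exact ⟨hw, irrHodge_form_le_logComplex hr x hw⟩⟩
  · intro x _ g hg
    rw [h0 x g hg]
    exact ⟨⊤, trivial, fun y _ ↦ zero_mem _⟩

theorem quasiIso_incl_irrHodge (r : ℝ) :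
    QuasiIso (Subcomplex.incl (Subcomplex.inf_le_left' (C.irrHodge r) C.logComplex)) := by
  rcases le_or_gt r 0 with hr | hr
  · exact quasiIso_incl_inf_logComplex (C.fnDivisor r) (fnDivisor_nonneg hr)
      (fun x hx ↦ by simp [fnDivisor, C.P_eq_zero hx]) (irrHodge_fn hr)
      (fun x ↦ by rw [irrHodge_form (by linarith), formDivisor_eq])
  · exact quasiIso_incl_irrHodge_of_pos hr

theorem quasiIso_incl_deligne (r : ℝ) :
    QuasiIso (Subcomplex.incl (Subcomplex.inf_le_left' (C.deligne r) C.logComplex)) := by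
  rcases le_or_gt r 0 with hr | hr
  · exact quasiIso_incl_inf_logComplex (C.deligneDivisor r) (deligneDivisor_nonneg hr)
      (fun x hx ↦ C.deligneDivisor_of_mem r hx) (deligne_fn hr)
      (fun x ↦ by rw [deligne_form (by linarith), deligneDivisor_sub_one hr])
  · rw [← irrHodge_eq_deligne hr]
    exact quasiIso_incl_irrHodge_of_pos hr

theorem quasiIso_incl_meromorphic : QuasiIso (Subcomplex.incl C.logComplex.le_meromorphic) := by
  refine quasiIso_incl _ ?_ ?_ ?_ ?_
  · intro x hx
    exact (C.meromorphic.form_regular x hx).trans (regularForms_le_logComplex hx)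
  · exact fun x g hg hgw ↦ mem_logComplex_fn C.meromorphic.fn_regular hg hgw
  · intro x hx w _
    obtain ⟨n, hn⟩ := C.exists_pole_form x w
    have := Pred_nonneg x
    obtain ⟨g, _, hgw⟩ := C.exists_sub_nabla_mem_log x (n := n) (by omega)
      (C.formsWithPole_mono x (by omega) hn)
    refine ⟨g, by simp [meromorphic, hx], ?_⟩
    rwa [logComplex_form, C.S_of_notMem hx]
  · intro x hx g _
    obtain ⟨V, hxV, hV⟩ := C.exists_nhd_regularFunctions x g
    refine ⟨V, hxV, fun y hy ↦ ?_⟩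
    by_cases hyx : y = x
    · simp [hyx, meromorphic, hx]
    · obtain ⟨hyU, hgy⟩ := hV y hy hyx
      simpa [meromorphic, hyU] using hgy

/-! ### The induced filtrations on cohomology -/

theorem incl_comp_incl {A B D : C.Subcomplex} (hAB : A ≤ B) (hBD : B ≤ D) (hAD : A ≤ D) :
    Subcomplex.incl hAB ≫ Subcomplex.incl hBD = Subcomplex.incl hAD :=
  double_comp_eq _ _ _ _ (Subcomplex.incl hAB) (Subcomplex.incl hBD) (Subcomplex.incl hAD)
    (HomologicalComplex.mkHomFromDouble_f₀ ..) (HomologicalComplex.mkHomFromDouble_f₁ ..)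
    (HomologicalComplex.mkHomFromDouble_f₀ ..) (HomologicalComplex.mkHomFromDouble_f₁ ..)
    (HomologicalComplex.mkHomFromDouble_f₀ ..) (HomologicalComplex.mkHomFromDouble_f₁ ..) rfl rfl

theorem surjective_hyper_map {Y : TopCat.{0}} (V : Opens Y) {L L' : CochainComplex (Sh Y) ℤ}
    (φ : L ⟶ L') [QuasiIso φ] (i : ℤ) : Function.Surjective (Hyper.map V φ i) := by
  have : IsIso (DerivedCategory.Q.map φ) := (DerivedCategory.isIso_Q_map_iff_quasiIso _ φ).2 ‹_›
  intro y
  refine ⟨y ≫ inv ((DerivedCategory.Q.map φ)⟦i⟧'), ?_⟩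
  change (y ≫ _) ≫ _ = y
  rw [Category.assoc, IsIso.inv_hom_id, Category.comp_id]

/-- Quasi-isomorphic subcomplexes have the same image in the cohomology. -/
theorem range_toHdR_eq {A B : C.Subcomplex} (h : A ≤ B) [QuasiIso (Subcomplex.incl h)] (i : ℤ) :
    LinearMap.range (A.toHdR i) = LinearMap.range (B.toHdR i) := by
  have h1 : A.toHdR i = B.toHdR i ∘ₗ Hyper.map ⊤ (Subcomplex.incl h) i := by
    ext y
    simp [Subcomplex.toHdR, Hyper.map, Hyper.res,
      ← incl_comp_incl h B.le_meromorphic A.le_meromorphic]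
  rw [h1, LinearMap.range_comp_of_range_eq_top _
    (LinearMap.range_eq_top.2 (surjective_hyper_map _ _ _))]

end CompletedCurve
end IrregularHodge

theorem mainTheorem10 (C : IrregularHodge.CompletedCurve) :
    (C.logComplex = C.deligneLogComplex ∧
      ∀ r : ℝ, C.irrHodge r ⊓ C.logComplex = C.deligne r ⊓ C.deligneLogComplex) ∧
    IrregularHodge.CompletedCurve.IsFilteredQuasiIso C.logComplex C.irrHodge ∧
    IrregularHodge.CompletedCurve.IsFilteredQuasiIso C.deligneLogComplex C.deligne ∧
    ∀ (r : ℝ) (i : ℤ),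
      IrregularHodge.CompletedCurve.inducedFiltration C.irrHodge r i =
        IrregularHodge.CompletedCurve.inducedFiltration C.deligne r i := by
  have hlog := IrregularHodge.CompletedCurve.logComplex_eq_deligneLogComplex (C := C)
  have hinf := IrregularHodge.CompletedCurve.irrHodge_inf_eq_deligne_inf (C := C)
  refine ⟨⟨hlog, hinf⟩, ⟨IrregularHodge.CompletedCurve.quasiIso_incl_meromorphic,
    IrregularHodge.CompletedCurve.quasiIso_incl_irrHodge⟩, ?_, fun r i ↦ ?_⟩
  · rw [← hlog]
    exact ⟨IrregularHodge.CompletedCurve.quasiIso_incl_meromorphic,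
      IrregularHodge.CompletedCurve.quasiIso_incl_deligne⟩
  · have h1 := IrregularHodge.CompletedCurve.quasiIso_incl_irrHodge (C := C) r
    have h2 := IrregularHodge.CompletedCurve.quasiIso_incl_deligne (C := C) r
    have h3 : LinearMap.range ((C.irrHodge r ⊓ C.logComplex).toHdR i) =
        LinearMap.range ((C.deligne r ⊓ C.logComplex).toHdR i) := by
      rw [hinf r, ← hlog]
    exact (IrregularHodge.CompletedCurve.range_toHdR_eq _ i).symm.trans
      (h3.trans (IrregularHodge.CompletedCurve.range_toHdR_eq _ i))
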